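/- Let $G$ be an étale groupoid, not necessarily Hausdorff: a topological groupoid whose unit space $G^{(0)}$ is locally compact Hausdorff and whose range map $r\colon G\to G^{(0)}$ is a local homeomorphism. Let $p\colon \mathcal A\to G$ be a Fell bundle over $G$, that is, an upper semicontinuous bundle of complex Banach spaces with a continuous, associative, submultiplicative, fibrewise bilinear multiplication $\mathcal A_\alpha\times\mathcal A_\beta\to\mathcal A_{\alpha\beta}$ (for composable $\alpha,\beta$) and a continuous, fibrewise conjugate-linear involution $\mathcal A_\alpha\to\mathcal A_{\alpha^{-1}}$, such that $(a^*)^*=a$, $(ab)^*=b^*a^*$, $\|a^*a\|=\|aa^*\|=\|a\|^2$ and $a^*a\ge 0$ in the C*-algebra $\mathcal A_{s(p(a))}$. Neither saturation nor separability is assumed. Let $C_c(G;\mathcal A)$ be the linear span of the sections of $p$ that vanish outside some compact subset $K$ of some open Hausdorff set $V\subseteq G$ and are continuous on $V$. It is a $*$-algebra under $(f*g)(\gamma)=\sum_{\alpha\beta=\gamma}f(\alpha)g(\beta)$ and $f^*(\gamma)=f(\gamma^{-1})^*$. The inductive limit topology on it is the finest locally convex topology for which the inclusion of each of the spaces of sections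 that are continuous on $V$ and vanish outside $K$ ($V$ open Hausdorff, $K\subseteq V$ compact), with the supremum norm $\|\cdot\|_\infty$, is continuous. Let $H$ be a complex Hilbert space. A pre-representation of $C_c(G;\mathcal A)$ on $H$ consists of a linear subspace $H_0\subseteq H$ and a homomorphism of complex algebras $L\colon C_c(G;\mathcal A)\to \mathrm{Lin}(H_0)$ into the algebra of all linear maps $H_0\to H_0$ such that, for all $\xi,\eta\in H_0$ and $f\in C_c(G;\mathcal A)$: (i) $f\mapsto\langle\eta,L(f)\xi\rangle$ is continuous in the inductive limit topology; (ii) $\langle\eta,L(f)\xi\rangle=\langle L(f^*)\eta,\xi\rangle$; (iii) $H_{00}:=\operatorname{span}\{L(f)\xi : f\in C_c(G;\mathcal A),\ \xi\in H_0\}$ is dense in $H$ (so $H_0\supseteq H_{00}$ is dense as well). **Proposition 2.5.** Let $(H_0,L)$ be a pre-representation of $C_c(G;\mathcal A)$ on $H$. For $h\in C_c(G;\mathcal A)$, the formula $$M'(h)(L(f)\xi)=L(h*f)\xi\qquad (f\in C_c(G;\mathcal A),\ \xi\in H_0)$$ gives a well-defined linear operator $M'(h)$ on $H_{00}$, and: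 1. $M'(h)$ extends to a (unique) bounded linear operator $M(h)\colon H\to H$; 2. $M\colon C_c(G;\mathcal A)\to \mathbb B(H)$, $h\mapsto M(h)$, is a nondegenerate $*$-homomorphism (that is, the vectors $M(h)v$ with $h\in C_c(G;\mathcal A)$ and $v\in H$ span a dense subspace of $H$), and it is continuous from the inductive limit topology to the operator norm topology; 3. $M$ extends $L$: $M(h)|_{H_0}=L(h)$ for all $h\in C_c(G;\mathcal A)$. Moreover, if $U\subseteq G$ is an open bisection (the range and source maps restrict to homeomorphisms of $U$ onto open subsets of $G^{(0)}$), $K\subseteq U$ is compact, and $h\in C_c(G;\mathcal A)$ is continuous on $U$ and vanishes outside $K$, then $\|M(h)v\|\le\|h\|_\infty\|v\|$ for all $v\in H$. -/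

import Mathlib

section

set_option linter.unusedSectionVars false

open Topology

/-- A groupoid (a small category in which every arrow is invertible), presented by its set `G` of
arrows. Objects are identified with their identity arrows (the units), so `rng` and `src` are maps
`G → G`. The composition `comp α β` is meaningful only if `src α = rng β`; its values on other pairs
are irrelevant. -/
class ArrowGroupoid (G : Type*) where
  rng : G → G
  src : G → G
  inv : G → G
  comp : G → G → G
  rng_rng : ∀ γ, rng (rng γ) = rng γ
  src_rng : ∀ γ, src (rng γ) = rng γ
  rng_src : ∀ γ, rng (src γ) = src γ
  src_src : ∀ γ, src (src γ) = src γ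
  rng_comp : ∀ α β, src α = rng β → rng (comp α β) = rng α
  src_comp : ∀ α β, src α = rng β → src (comp α β) = src β
  comp_assoc : ∀ α β γ, src α = rng β → src β = rng γ →
    comp (comp α β) γ = comp α (comp β γ)
  rng_comp_self : ∀ γ, comp (rng γ) γ = γ
  comp_src_self : ∀ γ, comp γ (src γ) = γ
  rng_inv : ∀ γ, rng (inv γ) = src γ
  src_inv : ∀ γ, src (inv γ) = rng γ
  comp_inv : ∀ γ, comp γ (inv γ) = rng γ
  inv_comp : ∀ γ, comp (inv γ) γ = src γ

namespace ArrowGroupoid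

/-- The unit space `G⁽⁰⁾`, as a subset of `G`. -/
def units (G : Type*) [ArrowGroupoid G] : Set G := Set.range (rng : G → G)

/-- The range map `r : G → G⁽⁰⁾`. -/
def rngMap {G : Type*} [ArrowGroupoid G] (γ : G) : units G := ⟨rng γ, γ, rfl⟩

/-- The source map `s : G → G⁽⁰⁾`. -/
def srcMap {G : Type*} [ArrowGroupoid G] (γ : G) : units G := ⟨src γ, src γ, rng_src γ⟩

/-- `IsComp α β γ` says that `(α, β)` is a composable pair and `α β = γ`. -/
def IsComp {G : Type*} [ArrowGroupoid G] (α β γ : G) : Prop := src α = rng β ∧ comp α β = γ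

section
variable {G : Type*} [ArrowGroupoid G]

theorem inv_inv_self (γ : G) : inv (inv γ) = γ := by
  have h1 : comp (comp (inv (inv γ)) (inv γ)) γ = γ := by
    rw [inv_comp, src_inv, rng_comp_self]
  rw [comp_assoc _ _ _ (by rw [src_inv]) (src_inv γ), inv_comp] at h1
  have h2 := comp_src_self (inv (inv γ))
  rw [src_inv, rng_inv] at h2
  rw [← h2, h1]

theorem IsComp.rng_eq {α β γ : G} (h : IsComp α β γ) : rng γ = rng α := by
  rw [← h.2, rng_comp _ _ h.1]

theorem IsComp.src_eq {α β γ : G} (h : IsComp α β γ) : src γ = src β := by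
  rw [← h.2, src_comp _ _ h.1]

/-- `α β = γ` determines `β = α⁻¹ γ`. -/
theorem IsComp.right_eq {α β γ : G} (h : IsComp α β γ) : β = comp (inv α) γ := by
  rw [← h.2, ← comp_assoc _ _ _ (src_inv α) h.1, inv_comp, h.1, rng_comp_self]

theorem isComp_of_rng_eq {α γ : G} (h : rng α = rng γ) : IsComp α (comp (inv α) γ) γ := by
  have h1 : src (inv α) = rng γ := by rw [src_inv, h]
  refine ⟨by rw [rng_comp _ _ h1, rng_inv], ?_⟩
  rw [← comp_assoc _ _ _ (rng_inv α).symm h1, comp_inv, h, rng_comp_self]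

theorem IsComp.star {α β γ : G} (h : IsComp α β γ) : IsComp (inv β) (inv α) (inv γ) := by
  have h0 : src (inv β) = rng (inv α) := by rw [src_inv, rng_inv, h.1]
  refine ⟨h0, ?_⟩
  have h2 : IsComp γ (inv β) α := by
    refine ⟨by rw [h.src_eq, rng_inv], ?_⟩
    rw [← h.2, comp_assoc _ _ _ h.1 (rng_inv β).symm, comp_inv, ← h.1, comp_src_self]
  have h3 := h2.right_eq
  have h4 : src (inv γ) = rng α := by rw [src_inv, h.rng_eq]
  rw [h3, comp_assoc _ _ _ h4 (rng_inv α).symm, comp_inv, ← h.rng_eq, ← src_inv, comp_src_self]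

theorem IsComp.assoc_right {α β γ αβ δ : G} (h : IsComp α β αβ) (k : IsComp αβ γ δ) :
    IsComp β γ (comp β γ) ∧ IsComp α (comp β γ) δ := by
  have h1 : src β = rng γ := by rw [← h.src_eq, k.1]
  refine ⟨⟨h1, rfl⟩, by rw [rng_comp _ _ h1, h.1], ?_⟩
  rw [← comp_assoc _ _ _ h.1 h1, h.2, k.2]

theorem isComp_inv {α β : G} (h : inv α = β) : IsComp β α (src α) ∧ IsComp α β (rng α) := by
  subst h
  exact ⟨⟨src_inv α, inv_comp α⟩, (rng_inv α).symm, comp_inv α⟩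

theorem inv_src (α : G) : inv (src α) = src α := by
  have h := comp_src_self (inv (src α))
  rwa [src_inv, rng_src, inv_comp, src_src, eq_comm] at h

theorem isComp_src (α : G) : IsComp (src α) (src α) (src α) := by
  refine ⟨by rw [src_src, rng_src], ?_⟩
  have h := rng_comp_self (src α)
  rwa [rng_src] at h

end

end ArrowGroupoid

open ArrowGroupoid

/-- A topological groupoid: all structure maps are continuous, `G⁽⁰⁾` and the set of composable
pairs carrying the subspace topologies. `G` need not be Hausdorff. -/
class IsTopologicalGroupoid (G : Type*) [TopologicalSpace G] [ArrowGroupoid G] : Prop where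
  continuous_rng : Continuous (rng : G → G)
  continuous_src : Continuous (src : G → G)
  continuous_inv : Continuous (inv : G → G)
  continuous_comp : Continuous fun p : {p : G × G // src p.1 = rng p.2} => comp p.1.1 p.1.2

/-- An étale groupoid: the unit space is locally compact Hausdorff and the range map is a local
homeomorphism onto the unit space with its subspace topology. -/
class IsEtaleGroupoid (G : Type*) [TopologicalSpace G] [ArrowGroupoid G] : Prop
    extends IsTopologicalGroupoid G where
  t2Space_units : T2Space (units G)
  locallyCompactSpace_units : LocallyCompactSpace (units G)
  isLocalHomeomorph_rngMap : IsLocalHomeomorph (rngMap : G → units G)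

/-- An (open) bisection: range and source restrict to homeomorphisms of `U` onto open subsets of
the unit space. -/
structure IsBisection {G : Type*} [TopologicalSpace G] [ArrowGroupoid G] (U : Set G) : Prop where
  isOpen : IsOpen U
  rng_isOpenEmbedding : IsOpenEmbedding (fun u : U => rngMap u.1)
  src_isOpenEmbedding : IsOpenEmbedding (fun u : U => srcMap u.1)

/-- The total space `𝒜 = ⨆_γ A γ` of a family of fibres; the points are pairs `⟨γ, a⟩` with
`a : A γ`, and the bundle map is `Bundle.TotalSpace.proj`. -/
abbrev BundleTotal {G : Type*} (A : G → Type*) := Bundle.TotalSpace Unit A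

/-- An upper semicontinuous bundle of (complex) Banach spaces with fibres `A γ`, `γ ∈ G`: the
Banach space structure of the fibres is given by the instance arguments, and the total space carries
a topology, which is not the disjoint union topology. -/
class IsUSCBanachBundle {G : Type*} [TopologicalSpace G] (A : G → Type*)
    [∀ γ, NormedAddCommGroup (A γ)] [∀ γ, NormedSpace ℂ (A γ)]
    [TopologicalSpace (BundleTotal A)] : Prop where
  completeSpace : ∀ γ, CompleteSpace (A γ)
  continuous_proj : Continuous (fun a : BundleTotal A => a.proj)
  isOpenMap_proj : IsOpenMap (fun a : BundleTotal A => a.proj)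
  upperSemicontinuous_norm : UpperSemicontinuous (fun a : BundleTotal A => ‖a.snd‖)
  /-- Addition is continuous on `{(a, b) | p a = p b} ⊆ 𝒜 × 𝒜`. -/
  continuous_add : Continuous
    (fun x : Bundle.TotalSpace (Unit × Unit) (fun γ => A γ × A γ) =>
      (⟨x.proj, x.snd.1 + x.snd.2⟩ : BundleTotal A))
  continuous_smul : Continuous (fun x : ℂ × BundleTotal A => (⟨x.2.proj, x.1 • x.2.snd⟩ : BundleTotal A))
  /-- If `p (aᵢ) → γ` and `‖aᵢ‖ → 0`, then `aᵢ → 0` in `A γ`. -/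
  zero_nhds : ∀ (γ : G), ∀ W ∈ 𝓝 (⟨γ, 0⟩ : BundleTotal A), ∃ V ∈ 𝓝 γ, ∃ ε > 0,
    ∀ a : BundleTotal A, a.proj ∈ V → ‖a.snd‖ < ε → a ∈ W

/-- A Fell bundle over an étale groupoid. The multiplication is given on fibres,
`A α × A β → A γ` whenever `α β = γ`, and so is the involution, `A α → A β` whenever `β = α⁻¹`.
No saturation or separability is assumed. -/
class FellBundle {G : Type*} [TopologicalSpace G] [ArrowGroupoid G] (A : G → Type*)
    [∀ γ, NormedAddCommGroup (A γ)] [∀ γ, NormedSpace ℂ (A γ)]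
    [TopologicalSpace (BundleTotal A)] extends IsUSCBanachBundle A where
  /-- The bilinear multiplication `A α × A β → A γ` for `α β = γ`. -/
  mul : ∀ {α β γ : G}, IsComp α β γ → (A α →ₗ[ℂ] A β →ₗ[ℂ] A γ)
  /-- The conjugate linear involution `A α → A β` for `β = α⁻¹`. -/
  adj : ∀ {α β : G}, inv α = β → (A α →ₛₗ[starRingEnd ℂ] A β)
  continuous_mul : Continuous
    (fun x : {x : BundleTotal A × BundleTotal A // src x.1.proj = rng x.2.proj} =>
      (⟨comp x.1.1.proj x.1.2.proj, mul ⟨x.2, rfl⟩ x.1.1.snd x.1.2.snd⟩ : BundleTotal A))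
  continuous_adj : Continuous (fun x : BundleTotal A => (⟨inv x.proj, adj rfl x.snd⟩ : BundleTotal A))
  mul_assoc : ∀ {α β γ αβ βγ δ : G} (h₁ : IsComp α β αβ) (h₂ : IsComp αβ γ δ)
    (h₃ : IsComp β γ βγ) (h₄ : IsComp α βγ δ) (a : A α) (b : A β) (c : A γ),
    mul h₂ (mul h₁ a b) c = mul h₄ a (mul h₃ b c)
  norm_mul_le : ∀ {α β γ : G} (h : IsComp α β γ) (a : A α) (b : A β), ‖mul h a b‖ ≤ ‖a‖ * ‖b‖
  adj_adj : ∀ {α β : G} (h : inv α = β) (k : inv β = α) (a : A α), adj k (adj h a) = a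
  adj_mul : ∀ {α β γ α' β' γ' : G} (h : IsComp α β γ) (k : IsComp β' α' γ') (hα : inv α = α')
    (hβ : inv β = β') (hγ : inv γ = γ') (a : A α) (b : A β),
    adj hγ (mul h a b) = mul k (adj hβ b) (adj hα a)
  norm_adj_mul_self : ∀ {α β γ : G} (h : inv α = β) (k : IsComp β α γ) (a : A α),
    ‖mul k (adj h a) a‖ = ‖a‖ ^ 2
  norm_mul_adj_self : ∀ {α β γ : G} (h : inv α = β) (k : IsComp α β γ) (a : A α),
    ‖mul k a (adj h a)‖ = ‖a‖ ^ 2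
  /-- `a* a ≥ 0` in the C*-algebra `A (src α)`, that is, `a* a = b* b` for some `b` in it. -/
  adj_mul_self_nonneg : ∀ {α β : G} (h : inv α = β) (k : IsComp β α (src α)) (a : A α),
    ∃ b : A (src α), mul k (adj h a) a = mul (isComp_src α) (adj (inv_src α) b) b

namespace FellBundle

section Sections

variable {G : Type*} [TopologicalSpace G] (A : G → Type*)
  [∀ γ, NormedAddCommGroup (A γ)] [∀ γ, NormedSpace ℂ (A γ)]
  [TopologicalSpace (BundleTotal A)] [IsUSCBanachBundle A]

variable {A} in
theorem continuousOn_zero_section (V : Set G) :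
    ContinuousOn (fun γ => (⟨γ, 0⟩ : BundleTotal A)) V := by
  refine Continuous.continuousOn (continuous_iff_continuousAt.2 fun γ => ?_)
  intro W hW
  obtain ⟨N, hN, ε, hε, h⟩ := IsUSCBanachBundle.zero_nhds γ W hW
  refine Filter.mem_map.2 (Filter.mem_of_superset hN fun δ hδ => h ⟨δ, 0⟩ hδ ?_)
  simpa using! hε

variable {A} in
theorem continuousOn_add_section {V : Set G} {f g : ∀ γ, A γ}
    (hf : ContinuousOn (fun γ => (⟨γ, f γ⟩ : BundleTotal A)) V)
    (hg : ContinuousOn (fun γ => (⟨γ, g γ⟩ : BundleTotal A)) V) :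
    ContinuousOn (fun γ => (⟨γ, f γ + g γ⟩ : BundleTotal A)) V := by
  have h : ContinuousOn (fun γ => (⟨γ, (f γ, g γ)⟩ :
      Bundle.TotalSpace (Unit × Unit) (fun γ => A γ × A γ))) V := by
    rw [(FiberBundle.Prod.isInducing_diag Unit A Unit A).continuousOn_iff]
    exact hf.prodMk hg
  exact (IsUSCBanachBundle.continuous_add (A := A)).comp_continuousOn h

variable {A} in
theorem continuousOn_smul_section {V : Set G} {φ : G → ℂ} {f : ∀ γ, A γ}
    (hφ : ContinuousOn φ V) (hf : ContinuousOn (fun γ => (⟨γ, f γ⟩ : BundleTotal A)) V) :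
    ContinuousOn (fun γ => (⟨γ, φ γ • f γ⟩ : BundleTotal A)) V :=
  (IsUSCBanachBundle.continuous_smul (A := A)).comp_continuousOn (hφ.prodMk hf)

/-- The sections of the bundle that are continuous on `V` and vanish outside `K`. It is used for
`V` open and Hausdorff and `K ⊆ V` compact. -/
def sectionsOn (V K : Set G) : Submodule ℂ (∀ γ, A γ) where
  carrier := {f | ContinuousOn (fun γ => (⟨γ, f γ⟩ : BundleTotal A)) V ∧ ∀ γ ∉ K, f γ = 0}
  add_mem' {f g} hf hg := ⟨continuousOn_add_section hf.1 hg.1, fun γ hγ => by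
    simp [hf.2 γ hγ, hg.2 γ hγ]⟩
  zero_mem' := ⟨continuousOn_zero_section V, fun _ _ => rfl⟩
  smul_mem' c f hf := ⟨continuousOn_smul_section continuousOn_const hf.1, fun γ hγ => by
    simp [hf.2 γ hγ]⟩

/-- `C_c(G; A)` in the sense of Connes: the linear span of the sections that vanish outside a
compact subset `K` of an open Hausdorff set `V` and are continuous on `V`. -/
def ccSections : Submodule ℂ (∀ γ, A γ) :=
  Submodule.span ℂ {f | ∃ V K : Set G, IsOpen V ∧ T2Space V ∧ IsCompact K ∧ K ⊆ V ∧
    f ∈ sectionsOn A V K}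

/-- The vector space `C_c(G; A)`. (A type synonym, so that it does not inherit the topology of
pointwise convergence.) -/
def Cc : Type _ := ccSections A

namespace Cc

instance : AddCommGroup (Cc A) := inferInstanceAs (AddCommGroup (ccSections A))
instance : Module ℂ (Cc A) := inferInstanceAs (Module ℂ (ccSections A))

variable {A}

/-- The section underlying an element of `C_c(G; A)`. -/
def toSection (f : Cc A) : ∀ γ, A γ := f.1

instance : CoeFun (Cc A) (fun _ => ∀ γ, A γ) := ⟨toSection⟩

@[ext] theorem ext {f g : Cc A} (h : ∀ γ, f γ = g γ) : f = g := Subtype.ext (funext h)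

@[simp] theorem add_apply (f g : Cc A) (γ : G) : (f + g) γ = f γ + g γ := rfl
@[simp] theorem zero_apply (γ : G) : (0 : Cc A) γ = 0 := rfl
@[simp] theorem neg_apply (f : Cc A) (γ : G) : (-f) γ = - f γ := rfl
@[simp] theorem smul_apply (c : ℂ) (f : Cc A) (γ : G) : (c • f) γ = c • f γ := rfl

variable (A) in
/-- The subspace of `C_c(G; A)` of the sections that are continuous on `V` and vanish outside `K`. -/
def supportedIn (V K : Set G) : Submodule ℂ (Cc A) :=
  (sectionsOn A V K).comap (ccSections A).subtype

theorem bddAbove_norm_of_mem {V K : Set G} (hK : IsCompact K) (hKV : K ⊆ V) {f : ∀ γ, A γ}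
    (hf : f ∈ sectionsOn A V K) : ∃ C, ∀ γ, ‖f γ‖ ≤ C := by
  have h : UpperSemicontinuousOn (fun γ => ‖f γ‖) K :=
    fun γ hγ c hc => ((hf.1.mono hKV) γ hγ).eventually
      (IsUSCBanachBundle.upperSemicontinuous_norm (A := A) ⟨γ, f γ⟩ c hc)
  obtain ⟨C, hC⟩ := h.bddAbove_of_isCompact hK
  refine ⟨max C 0, fun γ => ?_⟩
  by_cases hγ : γ ∈ K
  · exact (hC ⟨γ, hγ, rfl⟩).trans (le_max_left _ _)
  · simp [hf.2 γ hγ]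

theorem exists_norm_le (f : Cc A) : ∃ C, ∀ γ, ‖f γ‖ ≤ C := by
  obtain ⟨f, hf⟩ := f
  change ∃ C, ∀ γ, ‖f γ‖ ≤ C
  induction hf using Submodule.span_induction with
  | mem f hf =>
    obtain ⟨V, K, -, -, hK, hKV, hf⟩ := hf
    exact bddAbove_norm_of_mem hK hKV hf
  | zero => exact ⟨0, by simp⟩
  | add f g _ _ hf hg =>
    obtain ⟨C, hC⟩ := hf
    obtain ⟨D, hD⟩ := hg
    exact ⟨C + D, fun γ => (norm_add_le _ _).trans (add_le_add (hC γ) (hD γ))⟩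
  | smul c f _ hf =>
    obtain ⟨C, hC⟩ := hf
    refine ⟨‖c‖ * C, fun γ => ?_⟩
    rw [Pi.smul_apply, norm_smul]
    exact mul_le_mul_of_nonneg_left (hC γ) (norm_nonneg c)

/-- The supremum norm `‖f‖_∞` (the supremum is finite for every `f`). -/
noncomputable def supNorm (f : Cc A) : ℝ := ⨆ γ, ‖f γ‖

theorem norm_le_supNorm (f : Cc A) (γ : G) : ‖f γ‖ ≤ supNorm f := by
  obtain ⟨C, hC⟩ := exists_norm_le f
  exact le_ciSup (f := fun γ => ‖f γ‖) ⟨C, by rintro _ ⟨γ, rfl⟩; exact hC γ⟩ γ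

theorem supNorm_nonneg (f : Cc A) : 0 ≤ supNorm f := Real.iSup_nonneg fun _ => norm_nonneg _

variable (A) in
/-- The supremum norm as a norm on the additive group `C_c(G; A)`. -/
noncomputable def supAddGroupNorm : AddGroupNorm (Cc A) where
  toFun := supNorm
  map_zero' := by simp [supNorm]
  add_le' f g := Real.iSup_le (fun γ => (norm_add_le _ _).trans
    (add_le_add (norm_le_supNorm f γ) (norm_le_supNorm g γ)))
    (add_nonneg (supNorm_nonneg f) (supNorm_nonneg g))
  neg' f := by simp [supNorm]
  eq_zero_of_map_eq_zero' f hf := by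
    ext γ
    have h := norm_le_supNorm f γ
    rw [show supNorm f = 0 from hf] at h
    simpa using h

variable (A) in
/-- The topology of uniform convergence, that is, of the norm `‖·‖_∞`. -/
@[reducible] noncomputable def uniformTopology : TopologicalSpace (Cc A) :=
  (supAddGroupNorm A).toNormedAddCommGroup.toMetricSpace.toUniformSpace.toTopologicalSpace

variable (A) in
/-- The inductive limit topology on `C_c(G; A)`: the finest locally convex vector space topology
for which the inclusions of all the normed spaces `(supportedIn A V K, ‖·‖_∞)`, with `V ⊆ G` open
Hausdorff and `K ⊆ V` compact, are continuous. -/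
noncomputable instance inductiveLimitTopology : TopologicalSpace (Cc A) :=
  sInf {t | @IsTopologicalAddGroup (Cc A) t _ ∧ @ContinuousSMul ℂ (Cc A) _ _ t ∧
    @LocallyConvexSpace ℝ (Cc A) _ _ _ (Module.complexToReal (Cc A)) t ∧
    ∀ V K : Set G, IsOpen V → T2Space V → IsCompact K → K ⊆ V →
      @Continuous (supportedIn A V K) (Cc A)
        ((uniformTopology A).induced Subtype.val) t Subtype.val}

end Cc

end Sections


section Groupoid

variable {G : Type*} [TopologicalSpace G] [ArrowGroupoid G] [IsEtaleGroupoid G]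

theorem continuous_rngMap : Continuous (rngMap : G → units G) :=
  (IsTopologicalGroupoid.continuous_rng (G := G)).subtype_mk _

theorem rngMap_surjective : Function.Surjective (rngMap : G → units G) := by
  rintro ⟨_, γ, rfl⟩
  exact ⟨γ, rfl⟩

theorem rngMap_eq_iff {α β : G} : rngMap α = rngMap β ↔ rng α = rng β := Subtype.ext_iff

variable (G) in
theorem locallyCompactSpace_groupoid : LocallyCompactSpace G := by
  have := IsEtaleGroupoid.locallyCompactSpace_units (G := G)
  choose e hx he using IsEtaleGroupoid.isLocalHomeomorph_rngMap (G := G)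
  have : ∀ x : G, (𝓝 x).HasBasis
      (fun s => s ∈ 𝓝 (e x x) ∧ IsCompact s ∧ s ⊆ (e x).target)
      fun s => (e x).symm '' s := fun x => by
    rw [← (e x).symm_map_nhds_eq (hx x)]
    exact ((compact_basis_nhds (e x x)).hasBasis_self_subset
      ((e x).open_target.mem_nhds ((e x).map_source (hx x)))).map _
  refine .of_hasBasis this ?_
  rintro x s ⟨_, h₂, h₃⟩
  exact h₂.image_of_continuousOn ((e x).continuousOn_symm.mono h₃)

/-- An open set on which the range map is injective. -/
structure IsRangeSection (U : Set G) : Prop where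
  isOpen : IsOpen U
  injOn : Set.InjOn (rng : G → G) U

theorem IsRangeSection.t2Space {U : Set G} (hU : IsRangeSection U) : T2Space U := by
  have := IsEtaleGroupoid.t2Space_units (G := G)
  refine T2Space.of_injective_continuous (f := fun u : U => rngMap u.1) ?_
    (continuous_rngMap.comp continuous_subtype_val)
  intro u v huv
  exact Subtype.ext (hU.injOn u.2 v.2 (rngMap_eq_iff.1 huv))

theorem exists_isRangeSection (x : G) : ∃ U : Set G, x ∈ U ∧ IsRangeSection U := by
  obtain ⟨e, hx, he⟩ := IsEtaleGroupoid.isLocalHomeomorph_rngMap x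
  refine ⟨e.source, hx, e.open_source, fun a ha b hb hab => e.injOn ha hb ?_⟩
  rw [← he]
  exact rngMap_eq_iff.2 hab

/-- On the open set `{γ | rng γ ∈ rng U}` the unique `u ∈ U` with `rng u = rng γ` depends
continuously on `γ`. -/
theorem IsRangeSection.exists_section {U : Set G} (hU : IsRangeSection U) :
    ∃ (W : Set G) (u : G → G), IsOpen W ∧ (∀ γ, γ ∈ W ↔ ∃ v ∈ U, rng v = rng γ) ∧
      ContinuousOn u W ∧ ∀ γ ∈ W, u γ ∈ U ∧ rng (u γ) = rng γ := by
  have hl := IsEtaleGroupoid.isLocalHomeomorph_rngMap (G := G)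
  have ho : IsOpenEmbedding (fun v : U => rngMap v.1) := by
    refine .of_continuous_injective_isOpenMap (continuous_rngMap.comp continuous_subtype_val)
      (fun u v huv => Subtype.ext (hU.injOn u.2 v.2 (rngMap_eq_iff.1 huv)))
      (hl.isOpenMap.comp hU.isOpen.isOpenMap_subtype_val)
  rcases U.eq_empty_or_nonempty with rfl | ⟨u₀, hu₀⟩
  · exact ⟨∅, id, isOpen_empty, by simp, by simp, by simp⟩
  have : Nonempty U := ⟨⟨u₀, hu₀⟩⟩
  let e := ho.toOpenPartialHomeomorph
  have hmem : ∀ γ : G, γ ∈ (rngMap ⁻¹' Set.range (fun v : U => rngMap v.1) : Set G) ↔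
      ∃ v ∈ U, rng v = rng γ := by
    intro γ
    constructor
    · rintro ⟨v, hv⟩
      exact ⟨v, v.2, rngMap_eq_iff.1 hv⟩
    · rintro ⟨v, hv, h⟩
      exact ⟨⟨v, hv⟩, rngMap_eq_iff.2 h⟩
  refine ⟨rngMap ⁻¹' Set.range (fun v : U => rngMap v.1), fun γ => (e.symm (rngMap γ)).1,
    ho.isOpen_range.preimage continuous_rngMap, hmem, ?_, ?_⟩
  · refine continuous_subtype_val.comp_continuousOn
      (e.continuousOn_symm.comp continuous_rngMap.continuousOn ?_)
    intro γ hγ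
    simpa [e] using hγ
  · intro γ hγ
    refine ⟨(e.symm (rngMap γ)).2, rngMap_eq_iff.1 ?_⟩
    exact e.right_inv (x := rngMap γ) (by simpa [e] using hγ)

theorem finite_fibre {K : Set G} (hK : IsCompact K) (x : G) : {α ∈ K | rng α = x}.Finite := by
  choose U hxU hU using exists_isRangeSection (G := G)
  obtain ⟨t, ht⟩ := hK.elim_finite_subcover U (fun y => (hU y).isOpen)
    (fun y _ => Set.mem_iUnion.2 ⟨y, hxU y⟩)
  refine Set.Finite.subset (t.finite_toSet.biUnion
    (t := fun y => {α ∈ U y | rng α = x}) fun y _ => ?_) ?_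
  · refine Set.Subsingleton.finite ?_
    rintro a ⟨ha, hax⟩ b ⟨hb, hbx⟩
    exact (hU y).injOn ha hb (hax.trans hbx.symm)
  · rintro α ⟨hα, hx⟩
    obtain ⟨y, hy, hαy⟩ := Set.mem_iUnion₂.1 (ht hα)
    exact Set.mem_biUnion hy ⟨hαy, hx⟩

theorem continuousOn_comp {W : Set G} {a b : G → G} (ha : ContinuousOn a W)
    (hb : ContinuousOn b W) (h : ∀ γ ∈ W, src (a γ) = rng (b γ)) :
    ContinuousOn (fun γ => comp (a γ) (b γ)) W := by
  rw [continuousOn_iff_continuous_domRestrict] at *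
  exact (IsTopologicalGroupoid.continuous_comp (G := G)).comp
    ((ha.prodMk hb).subtype_mk fun γ => h γ.1 γ.2)

/-- The set `K L` of all products of composable pairs in `K × L`. -/
def mulSet (K L : Set G) : Set G := {γ | ∃ α ∈ K, ∃ β ∈ L, IsComp α β γ}

theorem isCompact_mulSet {K L : Set G} (hK : IsCompact K) (hL : IsCompact L) :
    IsCompact (mulSet K L) := by
  have := IsEtaleGroupoid.t2Space_units (G := G)
  have hs : Continuous (srcMap : G → units G) :=
    (IsTopologicalGroupoid.continuous_src (G := G)).subtype_mk _
  have hc : IsClosed {p : G × G | src p.1 = rng p.2} := by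
    have h := isClosed_eq (hs.comp continuous_fst) (continuous_rngMap.comp continuous_snd)
    convert h using 3 with p
    exact (Subtype.ext_iff (a1 := srcMap p.1) (a2 := rngMap p.2)).symm
  have h := (hc.isClosedEmbedding_subtypeVal.isCompact_preimage (hK.prod hL)).image
    (IsTopologicalGroupoid.continuous_comp (G := G))
  convert h using 1
  ext γ
  constructor
  · rintro ⟨α, hα, β, hβ, h, rfl⟩
    exact ⟨⟨(α, β), h⟩, ⟨hα, hβ⟩, rfl⟩
  · rintro ⟨⟨⟨α, β⟩, h⟩, ⟨hα, hβ⟩, rfl⟩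
    exact ⟨α, hα, β, hβ, h, rfl⟩

end Groupoid

section Convolution

variable {G : Type*} [TopologicalSpace G] [ArrowGroupoid G] {A : G → Type*}
  [∀ γ, NormedAddCommGroup (A γ)] [∀ γ, NormedSpace ℂ (A γ)]
  [TopologicalSpace (BundleTotal A)]

section
variable [FellBundle A]

/-- Convolution of sections: `(f * g) γ = ∑_{α β = γ} f α · g β`. -/
noncomputable def convSection (f g : ∀ γ, A γ) : ∀ γ, A γ := fun γ =>
  ∑ᶠ p : {p : G × G // IsComp p.1 p.2 γ}, mul p.2 (f p.1.1) (g p.1.2)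

/-- Involution of sections: `f* γ = (f γ⁻¹)*`. -/
def adjSection (f : ∀ γ, A γ) : ∀ γ, A γ := fun γ => adj (inv_inv_self γ) (f (inv γ))

/-- The pairs with product `γ` are the pairs `(α, α⁻¹ γ)`, where `α` has the same range as `γ`. -/
def fibreEquiv {α γ : G} (h : rng α = rng γ) :
    {δ : G // rng δ = rng α} ≃ {p : G × G // IsComp p.1 p.2 γ} where
  toFun δ := ⟨(δ.1, comp (inv δ.1) γ), isComp_of_rng_eq (δ.2.trans h)⟩
  invFun p := ⟨p.1.1, (p.2.rng_eq.symm).trans h.symm⟩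
  left_inv _ := rfl
  right_inv p := by
    obtain ⟨⟨a, b⟩, hp⟩ := p
    exact Subtype.ext (Prod.ext rfl hp.right_eq.symm)

/-- `f` has finite support in every fibre of the range map. -/
def FinFib (f : ∀ γ, A γ) : Prop := ∀ x : G, {α | f α ≠ 0 ∧ rng α = x}.Finite

theorem FinFib.finite_support {f : ∀ γ, A γ} (hf : FinFib f) {γ : G} {B : Type*} [Zero B]
    (T : {p : G × G // IsComp p.1 p.2 γ} → B) (hT : ∀ p, f p.1.1 = 0 → T p = 0) :
    (Function.support T).Finite := by
  refine Set.Finite.of_finite_image (f := fun p => p.1.1) ((hf (rng γ)).subset ?_) ?_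
  · rintro _ ⟨p, hp, rfl⟩
    exact ⟨fun h => hp (hT p h), p.2.rng_eq.symm⟩
  · rintro ⟨⟨a, b⟩, hp⟩ - ⟨⟨a', b'⟩, hp'⟩ - (h : a = a')
    subst h
    exact Subtype.ext (Prod.ext rfl (hp.right_eq.trans hp'.right_eq.symm))

theorem convSection_add_left {f f' g : ∀ γ, A γ} (hf : FinFib f) (hf' : FinFib f') :
    convSection (f + f') g = convSection f g + convSection f' g := by
  funext γ
  simp only [convSection, Pi.add_apply, map_add, LinearMap.add_apply]
  exact finsum_add_distrib (hf.finite_support _ fun p hp => by simp [hp])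
    (hf'.finite_support _ fun p hp => by simp [hp])

theorem convSection_add_right {f g g' : ∀ γ, A γ} (hf : FinFib f) :
    convSection f (g + g') = convSection f g + convSection f g' := by
  funext γ
  simp only [convSection, Pi.add_apply, map_add]
  exact finsum_add_distrib (hf.finite_support _ fun p hp => by simp [hp])
    (hf.finite_support _ fun p hp => by simp [hp])

theorem convSection_smul_left (c : ℂ) (f g : ∀ γ, A γ) :
    convSection (c • f) g = c • convSection f g := by
  funext γ
  simp only [convSection, Pi.smul_apply, map_smul, LinearMap.smul_apply]
  exact (smul_finsum c _).symm

theorem convSection_smul_right (c : ℂ) (f g : ∀ γ, A γ) :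
    convSection f (c • g) = c • convSection f g := by
  funext γ
  simp only [convSection, Pi.smul_apply, map_smul]
  exact (smul_finsum c _).symm

theorem convSection_zero_left (g : ∀ γ, A γ) : convSection 0 g = 0 := by
  funext γ; simp [convSection]

theorem convSection_zero_right (f : ∀ γ, A γ) : convSection f 0 = 0 := by
  funext γ; simp [convSection]

theorem convSection_assoc {f g h : ∀ γ, A γ} (hf : FinFib f) (hg : FinFib g) :
    convSection (convSection f g) h = convSection f (convSection g h) := by
  funext γ
  let X := {δ : G // rng δ = rng γ}
  have hq : ∀ a d : X, IsComp (comp (inv a.1) d.1) (comp (inv d.1) γ) (comp (inv a.1) γ) := by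
    intro a d
    have h1 := isComp_of_rng_eq (a.2.trans d.2.symm)
    have h2 := isComp_of_rng_eq d.2
    have h3 := h1.assoc_right h2
    have h4 := h3.2.right_eq
    rw [← h4]
    exact h3.1
  let Φ : X → X → A γ := fun d a =>
    mul (isComp_of_rng_eq a.2) (f a.1) (mul (hq a d) (g (comp (inv a.1) d.1))
      (h (comp (inv d.1) γ)))
  have hL : convSection (convSection f g) h γ = ∑ᶠ d : X, ∑ᶠ a : X, Φ d a := by
    rw [convSection, ← finsum_comp_equiv (fibreEquiv (rfl : rng γ = rng γ))]
    refine finsum_congr fun d => ?_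
    change mul _ (convSection f g d.1) _ = _
    have hd : rng γ = rng d.1 := d.2.symm
    rw [convSection, ← finsum_comp_equiv (fibreEquiv hd)]
    have hfin : (Function.support fun p : {p : G × G // IsComp p.1 p.2 d.1} =>
        mul p.2 (f p.1.1) (g p.1.2)).Finite := hf.finite_support _ fun p hp => by simp [hp]
    have hfin2 := hfin.preimage (fibreEquiv hd).injective.injOn
    refine ((((mul (isComp_of_rng_eq d.2)).flip (h (comp (inv d.1) γ))).toAddMonoidHom).map_finsum
      hfin2).trans ?_
    refine finsum_congr fun a => ?_
    exact mul_assoc _ _ _ _ _ _ _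
  have hR : convSection f (convSection g h) γ = ∑ᶠ a : X, ∑ᶠ d : X, Φ d a := by
    rw [convSection, ← finsum_comp_equiv (fibreEquiv (rfl : rng γ = rng γ))]
    refine finsum_congr fun a => ?_
    change mul _ _ (convSection g h (comp (inv a.1) γ)) = _
    let E : X ≃ {p : G × G // IsComp p.1 p.2 (comp (inv a.1) γ)} :=
      { toFun := fun d => ⟨(comp (inv a.1) d.1, comp (inv d.1) γ), hq a d⟩
        invFun := fun p => ⟨comp a.1 p.1.1, by
          have h1 := (isComp_of_rng_eq a.2).1
          rw [p.2.rng_eq] at h1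
          rw [rng_comp _ _ h1, a.2]⟩
        left_inv := fun d => Subtype.ext (isComp_of_rng_eq (a.2.trans d.2.symm)).2
        right_inv := by
          rintro ⟨⟨b, c⟩, hp⟩
          have h1 := (isComp_of_rng_eq a.2).1
          rw [hp.rng_eq] at h1
          have h2 : IsComp a.1 b (comp a.1 b) := ⟨h1, rfl⟩
          have h3 : b = comp (inv a.1) (comp a.1 b) := h2.right_eq
          have h4 : IsComp (comp a.1 b) c γ := by
            refine ⟨by rw [h2.src_eq, hp.1], ?_⟩
            rw [comp_assoc _ _ _ h1 hp.1, hp.2, (isComp_of_rng_eq a.2).2]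
          exact Subtype.ext (Prod.ext h3.symm h4.right_eq.symm) }
    rw [convSection, ← finsum_comp_equiv E]
    have hfin : (Function.support fun p : {p : G × G // IsComp p.1 p.2 (comp (inv a.1) γ)} =>
        mul p.2 (g p.1.1) (h p.1.2)).Finite := hg.finite_support _ fun p hp => by simp [hp]
    exact ((mul (isComp_of_rng_eq a.2) (f a.1)).toAddMonoidHom).map_finsum
      (hfin.preimage E.injective.injOn)
  rw [hL, hR]
  have hS : (Function.support (Function.uncurry Φ)).Finite := by
    have h1 : {a : X | f a.1 ≠ 0}.Finite := by
      refine Set.Finite.of_finite_image (f := Subtype.val) ((hf (rng γ)).subset ?_)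
        Subtype.val_injective.injOn
      rintro _ ⟨a, ha, rfl⟩
      exact ⟨ha, a.2⟩
    have h2 : ∀ a : X, {d : X | g (comp (inv a.1) d.1) ≠ 0}.Finite := by
      intro a
      refine Set.Finite.of_finite_image (f := fun d => comp (inv a.1) d.1)
        ((hg (src a.1)).subset ?_) ?_
      · rintro _ ⟨d, hd, rfl⟩
        have h3 := isComp_of_rng_eq (a.2.trans d.2.symm)
        exact ⟨hd, h3.1.symm⟩
      · intro d _ d' _ hdd
        have h3 := (isComp_of_rng_eq (a.2.trans d.2.symm)).2
        have h4 := (isComp_of_rng_eq (a.2.trans d'.2.symm)).2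
        apply Subtype.ext
        rw [← h3, ← h4]
        exact congrArg _ hdd
    refine (h1.biUnion (t := fun a => (fun d => (d, a)) '' {d : X | g (comp (inv a.1) d.1) ≠ 0})
      fun a _ => (h2 a).image _).subset ?_
    rintro ⟨d, a⟩ hda
    refine Set.mem_biUnion (x := a) (fun h0 => hda ?_) ⟨d, fun h0 => hda ?_, rfl⟩
    · simp [Φ, Function.uncurry, h0]
    · simp [Φ, Function.uncurry, h0]
  have hS2 : (Function.support (fun q : X × X => Φ q.2 q.1)).Finite :=
    hS.preimage (f := Prod.swap) Prod.swap_injective.injOn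
  have e1 := finsum_curry (Function.uncurry Φ) hS
  have e2 := finsum_curry (fun q : X × X => Φ q.2 q.1) hS2
  refine e1.symm.trans (Eq.trans ?_ e2)
  exact (finsum_comp_equiv (Equiv.prodComm X X) (f := Function.uncurry Φ)).symm

theorem adjSection_convSection {f g : ∀ γ, A γ} (hf : FinFib f) :
    adjSection (convSection f g) = convSection (adjSection g) (adjSection f) := by
  funext γ
  let E : {p : G × G // IsComp p.1 p.2 (inv γ)} ≃ {p : G × G // IsComp p.1 p.2 γ} :=
    { toFun := fun p => ⟨(inv p.1.2, inv p.1.1), by simpa only [inv_inv_self] using p.2.star⟩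
      invFun := fun p => ⟨(inv p.1.2, inv p.1.1), p.2.star⟩
      left_inv := fun p => Subtype.ext (Prod.ext (inv_inv_self _) (inv_inv_self _))
      right_inv := fun p => Subtype.ext (Prod.ext (inv_inv_self _) (inv_inv_self _)) }
  have hfin : (Function.support fun p : {p : G × G // IsComp p.1 p.2 (inv γ)} =>
      mul p.2 (f p.1.1) (g p.1.2)).Finite := hf.finite_support _ fun p hp => by simp [hp]
  rw [adjSection, convSection, convSection, ← finsum_comp_equiv E]
  refine (((adj (inv_inv_self γ)).toAddMonoidHom).map_finsum hfin).trans ?_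
  refine finsum_congr fun p => ?_
  have key : ∀ {α α' : G} (h : α = α') (k : inv α' = inv α) (u : ∀ γ, A γ),
      adj k (u α') = adj rfl (u α) := by
    intro α α' h k u
    subst h
    rfl
  change adj (inv_inv_self γ) (mul p.2 (f p.1.1) (g p.1.2)) =
    mul (E p).2 (adj (inv_inv_self _) (g (inv (inv p.1.2)))) (adj (inv_inv_self _) (f (inv (inv p.1.1))))
  rw [adj_mul p.2 (E p).2 rfl rfl, key (inv_inv_self p.1.2).symm, key (inv_inv_self p.1.1).symm]

theorem adjSection_adjSection (f : ∀ γ, A γ) : adjSection (adjSection f) = f := by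
  funext γ
  have key : ∀ {α : G} (h : α = γ) (k : inv (inv γ) = γ) (l : inv α = inv γ),
      adj k (adj l (f α)) = f γ := by
    intro α h k l
    subst h
    exact adj_adj _ _ _
  exact key (inv_inv_self γ) _ _

end

variable (A) in
/-- The sections that are continuous on an open set on which the range map is injective, and
vanish outside a compact subset of it. -/
def rangeSectionSet [IsEtaleGroupoid G] [IsUSCBanachBundle A] : Set (∀ γ, A γ) :=
  {f | ∃ U K : Set G, IsRangeSection U ∧ IsCompact K ∧ K ⊆ U ∧ f ∈ sectionsOn A U K}

theorem mem_span_rangeSectionSet [IsEtaleGroupoid G] [IsUSCBanachBundle A] {f : ∀ γ, A γ}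
    (hf : f ∈ ccSections A) : f ∈ Submodule.span ℂ (rangeSectionSet A) := by
  classical
  have hlc := locallyCompactSpace_groupoid G
  refine Submodule.span_le.2 ?_ hf
  rintro f ⟨V, K, hV, hT2, hK, hKV, hfc, hf0⟩
  have hlcV : LocallyCompactSpace V := hV.isOpenEmbedding_subtypeVal.locallyCompactSpace
  choose U hxU hU using exists_isRangeSection (G := G)
  obtain ⟨t, ht⟩ := hK.elim_finite_subcover U (fun y => (hU y).isOpen)
    (fun y _ => Set.mem_iUnion.2 ⟨y, hxU y⟩)
  let y : Fin t.card → G := fun i => (t.equivFin.symm i).1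
  have hKc : IsCompact ((Subtype.val : V → G) ⁻¹' K) := by
    rw [Subtype.isCompact_iff, Subtype.image_preimage_coe, Set.inter_eq_right.2 hKV]
    exact hK
  obtain ⟨φ, hφU, hφ1, -, -⟩ := exists_continuous_sum_one_of_isOpen_isCompact
    (s := fun i => (Subtype.val : V → G) ⁻¹' (U (y i)))
    (fun i => (hU (y i)).isOpen.preimage continuous_subtype_val) hKc (by
      intro v hv
      obtain ⟨z, hz, hvz⟩ := Set.mem_iUnion₂.1 (ht hv)
      refine Set.mem_iUnion.2 ⟨t.equivFin ⟨z, hz⟩, ?_⟩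
      simpa [y] using hvz)
  let ψ : Fin t.card → G → ℂ := fun i γ => if h : γ ∈ V then (φ i ⟨γ, h⟩ : ℂ) else 0
  have hψ : ∀ i, ContinuousOn (ψ i) V := by
    intro i
    rw [continuousOn_iff_continuous_domRestrict]
    have : V.domRestrict (ψ i) = fun v => (φ i v : ℂ) := by
      funext v
      simp [ψ, Set.domRestrict]
    rw [this]
    exact Complex.continuous_ofReal.comp (φ i).continuous
  have hsum : f = ∑ i, fun γ => ψ i γ • f γ := by
    funext γ
    rw [Finset.sum_apply, ← Finset.sum_smul]
    by_cases hγ : γ ∈ K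
    · have h1 := hφ1 (x := ⟨γ, hKV hγ⟩) hγ
      have h2 : ∑ i, ψ i γ = 1 := by
        simp only [ψ, hKV hγ, dif_pos]
        rw [← Complex.ofReal_sum]
        simp only [Finset.sum_apply, Pi.one_apply] at h1
        rw [h1, Complex.ofReal_one]
      rw [h2, one_smul]
    · rw [hf0 γ hγ, smul_zero]
  rw [hsum]
  refine Submodule.sum_mem _ fun i _ => Submodule.subset_span ?_
  refine ⟨V ∩ U (y i), Subtype.val '' (Subtype.val ⁻¹' K ∩ tsupport (φ i)),
    ⟨hV.inter (hU _).isOpen, (hU _).injOn.mono Set.inter_subset_right⟩,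
    (hKc.inter_right (isClosed_tsupport _)).image continuous_subtype_val, ?_, ?_, ?_⟩
  · rintro _ ⟨v, ⟨-, hv⟩, rfl⟩
    exact ⟨v.2, hφU i hv⟩
  · exact continuousOn_smul_section ((hψ i).mono Set.inter_subset_left)
      (hfc.mono Set.inter_subset_left)
  · intro γ hγ
    by_cases hγK : γ ∈ K
    · have h0 : φ i ⟨γ, hKV hγK⟩ = 0 := by
        by_contra h0
        exact hγ ⟨⟨γ, hKV hγK⟩, ⟨hγK, subset_tsupport _ h0⟩, rfl⟩
      simp [ψ, hKV hγK, h0]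
    · simp [hf0 γ hγK]

variable [IsEtaleGroupoid G] [FellBundle A]

theorem finFib_of_mem {f : ∀ γ, A γ} (hf : f ∈ ccSections A) : FinFib f := by
  induction hf using Submodule.span_induction with
  | mem f hf =>
    obtain ⟨V, K, -, -, hK, -, hf⟩ := hf
    intro x
    refine (finite_fibre hK x).subset fun α hα => ⟨?_, hα.2⟩
    by_contra h
    exact hα.1 (hf.2 α h)
  | zero => intro x; simp
  | add f g _ _ hf hg =>
    intro x
    refine ((hf x).union (hg x)).subset ?_
    rintro α ⟨hα, hx⟩
    by_contra h
    simp only [Set.mem_union, Set.mem_ofPred_eq, not_or, not_and', not_not] at h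
    exact hα (by simp [h.1 hx, h.2 hx])
  | smul c f _ hf =>
    intro x
    refine (hf x).subset ?_
    rintro α ⟨hα, hx⟩
    exact ⟨fun h => hα (by simp [h]), hx⟩

theorem mk_mul_eq {α β γ : G} (h : IsComp α β γ) (a : A α) (b : A β) :
    (⟨γ, mul h a b⟩ : BundleTotal A) = ⟨comp α β, mul ⟨h.1, rfl⟩ a b⟩ := by
  obtain ⟨h1, rfl⟩ := h
  rfl

theorem mk_adj_eq {α β : G} (h : inv α = β) (a : A α) :
    (⟨β, adj h a⟩ : BundleTotal A) = ⟨inv α, adj rfl a⟩ := by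
  subst h
  rfl

theorem convSection_mem_of_rangeSection {f g : ∀ γ, A γ} (hf : f ∈ rangeSectionSet A)
    (hg : g ∈ rangeSectionSet A) : convSection f g ∈ ccSections A := by
  obtain ⟨U, K, hU, hK, hKU, hfc, hf0⟩ := hf
  obtain ⟨V, L, hV, hL, hLV, hgc, hg0⟩ := hg
  obtain ⟨W, u, hWo, hW, huc, hu⟩ := hU.exists_section
  have hinv := (IsTopologicalGroupoid.continuous_inv (G := G))
  have hsc : ∀ γ ∈ W, src (inv (u γ)) = rng γ := fun γ hγ => by rw [src_inv, (hu γ hγ).2]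
  have hcc : ContinuousOn (fun γ => comp (inv (u γ)) γ) W :=
    continuousOn_comp (hinv.comp_continuousOn huc) continuousOn_id hsc
  have hic : ∀ γ ∈ W, IsComp (u γ) (comp (inv (u γ)) γ) γ := fun γ hγ =>
    isComp_of_rng_eq (hu γ hγ).2
  let W' : Set G := W ∩ (fun γ => comp (inv (u γ)) γ) ⁻¹' V
  have hW'o : IsOpen W' := hcc.isOpen_inter_preimage hWo hV.isOpen
  have huniq : ∀ γ ∈ W, ∀ α ∈ U, rng α = rng γ → α = u γ := fun γ hγ α hα h =>
    hU.injOn hα (hu γ hγ).1 (h.trans (hu γ hγ).2.symm)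
  have hW'r : IsRangeSection W' := by
    refine ⟨hW'o, ?_⟩
    rintro γ ⟨hγ, hγV⟩ γ' ⟨hγ', hγV'⟩ h
    have h1 : u γ = u γ' := huniq γ' hγ' (u γ) (hu γ hγ).1 ((hu γ hγ).2.trans h)
    have h2 : comp (inv (u γ)) γ = comp (inv (u γ')) γ' := by
      refine hV.injOn hγV hγV' ?_
      rw [← (hic γ hγ).1, ← (hic γ' hγ').1, h1]
    rw [← (hic γ hγ).2, ← (hic γ' hγ').2, ← h2, ← h1]
  have hval : ∀ γ (hγ : γ ∈ W), convSection f g γ =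
      mul (hic γ hγ) (f (u γ)) (g (comp (inv (u γ)) γ)) := by
    intro γ hγ
    refine finsum_eq_single _ (⟨(u γ, comp (inv (u γ)) γ), hic γ hγ⟩ :
      {p : G × G // IsComp p.1 p.2 γ}) ?_
    rintro ⟨⟨a, b⟩, hp⟩ hne
    have ha : f a = 0 := by
      refine hf0 a fun haK => hne ?_
      have h1 := huniq γ hγ a (hKU haK) hp.rng_eq.symm
      subst h1
      exact Subtype.ext (Prod.ext rfl hp.right_eq)
    simp [ha]
  refine Submodule.subset_span ⟨W', mulSet K L, hW'o, hW'r.t2Space, isCompact_mulSet hK hL,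
    ?_, ?_, ?_⟩
  · rintro γ ⟨α, hα, β, hβ, h⟩
    have hγ : γ ∈ W := (hW γ).2 ⟨α, hKU hα, h.rng_eq.symm⟩
    refine ⟨hγ, ?_⟩
    change comp (inv (u γ)) γ ∈ V
    rw [← huniq γ hγ α (hKU hα) h.rng_eq.symm, ← h.right_eq]
    exact hLV hβ
  · have h1 : ContinuousOn (fun γ => (⟨u γ, f (u γ)⟩ : BundleTotal A)) W' :=
      (hfc.comp huc fun γ hγ => (hu γ hγ).1).mono Set.inter_subset_left
    have h2 : ContinuousOn (fun γ => (⟨comp (inv (u γ)) γ, g (comp (inv (u γ)) γ)⟩ :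
        BundleTotal A)) W' :=
      hgc.comp (hcc.mono Set.inter_subset_left) fun γ hγ => hγ.2
    rw [continuousOn_iff_continuous_domRestrict] at *
    have h3 := (FellBundle.continuous_mul (A := A)).comp
      ((h1.prodMk h2).subtype_mk fun γ => (hic γ.1 γ.2.1).1)
    convert h3 using 1
    funext γ
    change (⟨γ.1, convSection f g γ.1⟩ : BundleTotal A) = _
    rw [hval γ.1 γ.2.1, mk_mul_eq]
    rfl
  · intro γ hγ
    refine (finsum_congr fun p => ?_).trans finsum_zero
    by_cases h1 : p.1.1 ∈ K
    · by_cases h2 : p.1.2 ∈ L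
      · exact absurd ⟨_, h1, _, h2, p.2⟩ hγ
      · simp [hg0 _ h2]
    · simp [hf0 _ h1]

theorem rangeSectionSet_subset : rangeSectionSet A ⊆ ccSections A := by
  rintro f ⟨U, K, hU, hK, hKU, hf⟩
  exact Submodule.subset_span ⟨U, K, hU.isOpen, hU.t2Space, hK, hKU, hf⟩

theorem span_rangeSectionSet_le : Submodule.span ℂ (rangeSectionSet A) ≤ ccSections A :=
  Submodule.span_le.2 rangeSectionSet_subset

theorem convSection_mem_aux {f g : ∀ γ, A γ} (hf : f ∈ rangeSectionSet A)
    (hg : g ∈ Submodule.span ℂ (rangeSectionSet A)) : convSection f g ∈ ccSections A := by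
  induction hg using Submodule.span_induction with
  | mem g hg => exact convSection_mem_of_rangeSection hf hg
  | zero => rw [convSection_zero_right]; exact Submodule.zero_mem _
  | add g g' _ _ ih ih' =>
    rw [convSection_add_right (finFib_of_mem (rangeSectionSet_subset hf))]
    exact Submodule.add_mem _ ih ih'
  | smul c g _ ih =>
    rw [convSection_smul_right]
    exact Submodule.smul_mem _ _ ih

/-- `C_c(G; A)` is closed under convolution. -/
theorem convSection_mem {f g : ∀ γ, A γ} (hf : f ∈ ccSections A) (hg : g ∈ ccSections A) :
    convSection f g ∈ ccSections A := by
  replace hf := mem_span_rangeSectionSet hf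
  replace hg := mem_span_rangeSectionSet hg
  induction hf using Submodule.span_induction with
  | mem f hf => exact convSection_mem_aux hf hg
  | zero => rw [convSection_zero_left]; exact Submodule.zero_mem _
  | add f f' hf hf' ih ih' =>
    rw [convSection_add_left (finFib_of_mem (span_rangeSectionSet_le hf))
      (finFib_of_mem (span_rangeSectionSet_le hf'))]
    exact Submodule.add_mem _ ih ih'
  | smul c f _ ih =>
    rw [convSection_smul_left]
    exact Submodule.smul_mem _ _ ih

/-- `C_c(G; A)` is closed under the involution. -/
theorem adjSection_mem {f : ∀ γ, A γ} (hf : f ∈ ccSections A) : adjSection f ∈ ccSections A := by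
  induction hf using Submodule.span_induction with
  | mem f hf =>
    obtain ⟨V, K, hV, hT2, hK, hKV, hfc, hf0⟩ := hf
    have hinv := (IsTopologicalGroupoid.continuous_inv (G := G))
    have hKe : inv ⁻¹' K = inv '' K := by
      ext γ
      exact ⟨fun h => ⟨_, h, inv_inv_self γ⟩, by rintro ⟨δ, hδ, rfl⟩; simpa [inv_inv_self]⟩
    refine Submodule.subset_span ⟨inv ⁻¹' V, inv ⁻¹' K, hV.preimage hinv, ?_, ?_,
      Set.preimage_mono hKV, ?_, fun γ hγ => ?_⟩
    · refine T2Space.of_injective_continuous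
        (f := fun v : (inv ⁻¹' V : Set G) => (⟨inv v.1, v.2⟩ : V)) ?_
        ((hinv.comp continuous_subtype_val).subtype_mk _)
      intro v w hvw
      have h := congrArg (fun z : V => inv z.1) hvw
      exact Subtype.ext (by simpa [inv_inv_self] using h)
    · rw [hKe]
      exact hK.image hinv
    · have h := (FellBundle.continuous_adj (A := A)).comp_continuousOn
        (hfc.comp hinv.continuousOn (s := inv ⁻¹' V) fun γ hγ => hγ)
      convert h using 1
      funext γ
      exact mk_adj_eq _ _
    · simp [adjSection, hf0 (inv γ) hγ]
  | zero =>
    convert Submodule.zero_mem (ccSections A) using 1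
    funext γ
    simp [adjSection]
  | add f g _ _ hf hg =>
    convert Submodule.add_mem _ hf hg using 1
    funext γ
    simp [adjSection]
  | smul c f _ hf =>
    convert Submodule.smul_mem _ (starRingEnd ℂ c) hf using 1
    funext γ
    simp [adjSection]

namespace Cc

noncomputable instance : Mul (Cc A) := ⟨fun f g => ⟨convSection f g, convSection_mem f.2 g.2⟩⟩
noncomputable instance : Star (Cc A) := ⟨fun f => ⟨adjSection f, adjSection_mem f.2⟩⟩

/-- Convolution. -/
theorem mul_apply (f g : Cc A) (γ : G) :
    (f * g) γ = ∑ᶠ p : {p : G × G // IsComp p.1 p.2 γ}, mul p.2 (f p.1.1) (g p.1.2) := rfl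

/-- Involution. -/
theorem star_apply (f : Cc A) (γ : G) : (star f) γ = adj (inv_inv_self γ) (f (inv γ)) := rfl

theorem finFib (f : Cc A) : FinFib (f : ∀ γ, A γ) := finFib_of_mem f.2

/-- The `*`-algebra structure of `C_c(G; A)`. -/
noncomputable instance : NonUnitalRing (Cc A) :=
  { (inferInstance : AddCommGroup (Cc A)), (inferInstance : Mul (Cc A)) with
    left_distrib := fun f _ _ => Subtype.ext (convSection_add_right f.finFib)
    right_distrib := fun f g _ => Subtype.ext (convSection_add_left f.finFib g.finFib)
    zero_mul := fun f => Subtype.ext (convSection_zero_left f.1)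
    mul_zero := fun f => Subtype.ext (convSection_zero_right f.1)
    mul_assoc := fun f g _ => Subtype.ext (convSection_assoc f.finFib g.finFib) }

noncomputable instance : StarRing (Cc A) where
  star_involutive f := Subtype.ext (adjSection_adjSection f.1)
  star_mul f _ := Subtype.ext (adjSection_convSection f.finFib)
  star_add f g := by ext γ; simp [star_apply]

instance : StarModule ℂ (Cc A) where
  star_smul c f := by ext γ; simp [star_apply]

instance : IsScalarTower ℂ (Cc A) (Cc A) where
  smul_assoc c f g := Subtype.ext (convSection_smul_left c f.1 g.1)

instance : SMulCommClass ℂ (Cc A) (Cc A) where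
  smul_comm c f g := Subtype.ext (convSection_smul_right c f.1 g.1).symm

end Cc

end Convolution

section Representations

variable {G : Type*} [TopologicalSpace G] [ArrowGroupoid G] [IsEtaleGroupoid G] {A : G → Type*}
  [∀ γ, NormedAddCommGroup (A γ)] [∀ γ, NormedSpace ℂ (A γ)]
  [TopologicalSpace (BundleTotal A)] [FellBundle A]
  {H : Type*} [NormedAddCommGroup H] [InnerProductSpace ℂ H]

/-- `H₀₀ = span {L(f) ξ | f ∈ C_c(G; A), ξ ∈ H₀}`, for an algebra homomorphism `L` from `C_c(G; A)`
to the linear operators on the subspace `H₀` of `H`. -/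
def spanRange {H₀ : Submodule ℂ H} (L : Cc A →ₙₐ[ℂ] Module.End ℂ H₀) : Submodule ℂ H :=
  Submodule.span ℂ {v : H | ∃ (f : Cc A) (ξ : H₀), v = L f ξ}

theorem apply_mem_spanRange {H₀ : Submodule ℂ H} (L : Cc A →ₙₐ[ℂ] Module.End ℂ H₀) (f : Cc A)
    (ξ : H₀) : (L f ξ : H) ∈ spanRange L :=
  Submodule.subset_span ⟨f, ξ, rfl⟩

/-- A pre-representation of `C_c(G; A)` on `H`: a subspace `H₀` of `H` and an algebra homomorphism
`L : C_c(G; A) → Lin(H₀)` with the following properties. -/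
structure IsPreRepresentation (H₀ : Submodule ℂ H) (L : Cc A →ₙₐ[ℂ] Module.End ℂ H₀) : Prop where
  /-- The matrix coefficients are continuous in the inductive limit topology. -/
  continuous_inner : ∀ ξ η : H₀, Continuous (fun f : Cc A => inner ℂ (η : H) (L f ξ : H))
  /-- `⟨η, L(f) ξ⟩ = ⟨L(f*) η, ξ⟩`. -/
  inner_apply : ∀ (ξ η : H₀) (f : Cc A),
    inner ℂ (η : H) (L f ξ : H) = inner ℂ (L (star f) η : H) (ξ : H)
  /-- `H₀₀` is dense in `H`. -/
  dense_spanRange : Dense (spanRange L : Set H)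

/-- A *-homomorphism `M : C_c(G; A) → B(H)` is nondegenerate if the vectors `M(f) v` span a dense
subspace. -/
def IsNondegenerate [CompleteSpace H] (M : Cc A →⋆ₙₐ[ℂ] (H →L[ℂ] H)) : Prop :=
  Dense (Submodule.span ℂ {w : H | ∃ (f : Cc A) (v : H), w = M f v} : Set H)

end Representations

end FellBundle

end

/-!
Each `L h` leaves `H₀` invariant and satisfies `L h (L f ξ) = L (h * f) ξ`, so everything reduces to
showing that `L h` is bounded on `H₀`, with a bound that is uniform on the sections supported in a
fixed compact set.

Let `h` be supported in a compact subset `K` of an open bisection `U`, and put `b = h* * h`. In the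
sum defining `b` only products `β⁻¹ β` with `β ∈ K` contribute, so `b` is a section over the open
subset `s(U)` of the unit space, supported in `s(K)`, with `‖b‖_∞ ≤ ‖h‖_∞²`
(`star_mul_self_mem_supportedIn`). Products of such sections are pointwise products in the fibres
over the units, so all the powers `b ^ (2 ^ n)` have support in `s(K)` and sup norm at most
`‖h‖_∞ ^ (2 * 2 ^ n)` (`mul_mem_supportedIn_of_subset_units`). For `ξ ∈ H₀` the Cauchy-Schwarz
inequality gives `|⟨ξ, L(b) ξ⟩|² ≤ ‖ξ‖² |⟨ξ, L(b²) ξ⟩|`, and by iteration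
`(|⟨ξ, L(b) ξ⟩| / ‖ξ‖²) ^ (2 ^ n) ≤ |⟨ξ, L(b ^ (2 ^ n)) ξ⟩| / ‖ξ‖²`. As the matrix coefficient
`f ↦ ⟨ξ, L(f) ξ⟩` is continuous in the inductive limit topology, it is bounded by `C ‖f‖_∞` on the
sections supported in `s(K)`, whence the right-hand side is at most `(C / ‖ξ‖²) ‖h‖_∞ ^ (2 * 2 ^ n)`.
Taking `2 ^ n`-th roots removes the unknown constant `C`:
`‖L(h) ξ‖² = |⟨ξ, L(b) ξ⟩| ≤ ‖h‖_∞² ‖ξ‖²` (`IsPreRepresentation.norm_apply_le`).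

A section supported in a compact subset `K` of an open Hausdorff set is, by a partition of unity, a
sum of `n = n(K)` sections supported in bisections whose sup norms are no larger
(`exists_sum_supportedIn`). Hence `‖L(h) ξ‖ ≤ n ‖h‖_∞ ‖ξ‖`, and `L h` extends to `H`. The algebraic
properties of the extension follow by density. It is continuous because the topology that it induces
on `C_c(G; A)` is locally convex and makes the inclusions of the spaces of supported sections
continuous, so it is coarser than the inductive limit topology.
-/

open Topology ArrowGroupoid

namespace FellBundle

/-! ### Units and bisections -/

section Units

variable {G : Type*} [ArrowGroupoid G]

theorem rng_eq_self_of_mem_units {x : G} (hx : x ∈ units G) : rng x = x := by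
  obtain ⟨γ, rfl⟩ := hx
  exact rng_rng γ

theorem src_eq_self_of_mem_units {x : G} (hx : x ∈ units G) : src x = x := by
  obtain ⟨γ, rfl⟩ := hx
  exact src_rng γ

theorem src_mem_units (γ : G) : src γ ∈ units G := ⟨src γ, rng_src γ⟩

theorem isComp_self_of_mem_units {x : G} (hx : x ∈ units G) : IsComp x x x := by
  simpa only [src_eq_self_of_mem_units hx] using isComp_src x

theorem eq_of_isComp_of_mem_units {α β γ : G} (h : IsComp α β γ) (hα : α ∈ units G) :
    β = γ ∧ rng γ = α := by
  have h1 : rng β = α := by rw [← h.1, src_eq_self_of_mem_units hα]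
  have h2 : γ = β := by rw [← h.2, ← h1, rng_comp_self]
  exact ⟨h2.symm, h2 ▸ h1⟩

theorem isComp_left_unique {α α' β γ : G} (h : IsComp α β γ) (h' : IsComp α' β γ) : α = α' := by
  rw [← inv_inv_self α, ← inv_inv_self α', h.star.right_eq, h'.star.right_eq]

variable [TopologicalSpace G]

/-- In particular, an open set of units is Hausdorff, even if `G` is not. -/
theorem isRangeSection_of_subset_units {V : Set G} (hV : IsOpen V) (hVu : V ⊆ units G) :
    IsRangeSection V :=
  ⟨hV, fun x hx y hy h => by
    rwa [rng_eq_self_of_mem_units (hVu hx), rng_eq_self_of_mem_units (hVu hy)] at h⟩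

variable [IsEtaleGroupoid G]

variable (G) in
/-- If the range map is injective on a neighbourhood `U` of a unit, then every `γ ∈ U` with
`r(γ) ∈ U` is equal to `r(γ)`. -/
theorem isOpen_units : IsOpen (units G) := by
  rw [isOpen_iff_mem_nhds]
  intro x hx
  obtain ⟨U, hxU, hU⟩ := exists_isRangeSection x
  have hr := IsTopologicalGroupoid.continuous_rng (G := G)
  refine Filter.mem_of_superset (((hU.isOpen.preimage hr).inter hU.isOpen).mem_nhds
    ⟨by rwa [Set.mem_preimage, rng_eq_self_of_mem_units hx], hxU⟩) ?_
  rintro γ ⟨hγ, hγU⟩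
  exact ⟨γ, hU.injOn hγ hγU (rng_rng γ)⟩

theorem isOpen_image_src {U : Set G} (hU : IsOpen U) : IsOpen (src '' U) := by
  have hr : IsOpenMap (rng : G → G) := (isOpen_units G).isOpenMap_subtype_val.comp
    (IsEtaleGroupoid.isLocalHomeomorph_rngMap (G := G)).isOpenMap
  convert hr _ (hU.preimage (IsTopologicalGroupoid.continuous_inv (G := G))) using 1
  ext x
  constructor
  · rintro ⟨γ, hγ, rfl⟩
    exact ⟨inv γ, by simpa [inv_inv_self] using hγ, rng_inv γ⟩
  · rintro ⟨γ, hγ, rfl⟩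
    exact ⟨inv γ, hγ, src_inv γ⟩

theorem exists_isRangeSection_injOn_src (x : G) :
    ∃ U : Set G, x ∈ U ∧ IsRangeSection U ∧ Set.InjOn src U := by
  obtain ⟨U, hxU, hU⟩ := exists_isRangeSection x
  obtain ⟨V, hxV, hV⟩ := exists_isRangeSection (inv x)
  refine ⟨U ∩ inv ⁻¹' V, ⟨hxU, hxV⟩,
    ⟨hU.isOpen.inter (hV.isOpen.preimage (IsTopologicalGroupoid.continuous_inv (G := G))),
      hU.injOn.mono Set.inter_subset_left⟩, ?_⟩
  intro α hα β hβ h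
  rw [← inv_inv_self α, ← inv_inv_self β]
  exact congrArg inv (hV.injOn hα.2 hβ.2 (by rw [rng_inv, rng_inv, h]))

/-- The inverse of the source map on an open set `U` on which it is injective, as a continuous
map `src '' U → U`. -/
theorem exists_continuousOn_inverse_src {U : Set G} (hU : IsOpen U) (hs : Set.InjOn src U) :
    ∃ b : G → G, ContinuousOn b (src '' U) ∧ ∀ x ∈ src '' U, b x ∈ U ∧ src (b x) = x := by
  have hinv := IsTopologicalGroupoid.continuous_inv (G := G)
  have hU' : IsRangeSection (inv ⁻¹' U) := by
    refine ⟨hU.preimage hinv, fun α hα β hβ h => ?_⟩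
    rw [← inv_inv_self α, ← inv_inv_self β]
    exact congrArg inv (hs hα hβ (by rw [src_inv, src_inv, h]))
  obtain ⟨W, u, -, hW, huc, hu⟩ := hU'.exists_section
  have hsub : src '' U ⊆ W := by
    rintro _ ⟨γ, hγ, rfl⟩
    exact (hW _).2 ⟨inv γ, by simpa [inv_inv_self] using hγ, by rw [rng_inv, rng_src]⟩
  refine ⟨fun x => inv (u x), hinv.comp_continuousOn (huc.mono hsub), fun x hx => ?_⟩
  obtain ⟨h1, h2⟩ := hu x (hsub hx)
  refine ⟨h1, ?_⟩
  obtain ⟨γ, -, rfl⟩ := hx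
  rw [src_inv, h2, rng_src]

end Units

/-! ### Sections supported in the unit space, and sections supported in bisections -/

theorem Cc.supNorm_le {G : Type*} [TopologicalSpace G] {A : G → Type*}
    [∀ γ, NormedAddCommGroup (A γ)] [∀ γ, NormedSpace ℂ (A γ)]
    [TopologicalSpace (BundleTotal A)] [IsUSCBanachBundle A] {f : Cc A} {C : ℝ} (hC : 0 ≤ C)
    (h : ∀ γ, ‖f γ‖ ≤ C) : Cc.supNorm f ≤ C :=
  Real.iSup_le h hC

section UnitSupport

variable {G : Type*} [TopologicalSpace G] [ArrowGroupoid G] [IsEtaleGroupoid G] {A : G → Type*}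
  [∀ γ, NormedAddCommGroup (A γ)] [∀ γ, NormedSpace ℂ (A γ)]
  [TopologicalSpace (BundleTotal A)] [FellBundle A]

/-- A section supported on units acts by multiplication in the fibres over the units. -/
theorem mul_apply_unit {f g : Cc A} (hf : ∀ γ ∉ units G, f γ = 0) {x : G} (hx : x ∈ units G) :
    (f * g) x = mul (isComp_self_of_mem_units hx) (f x) (g x) := by
  rw [Cc.mul_apply]
  refine finsum_eq_single _ (⟨(x, x), isComp_self_of_mem_units hx⟩ :
    {p : G × G // IsComp p.1 p.2 x}) ?_
  rintro ⟨⟨a, b⟩, hp⟩ hne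
  have ha : f a = 0 := by
    refine hf a fun ha => hne ?_
    obtain ⟨h1, h2⟩ := eq_of_isComp_of_mem_units hp ha
    rw [rng_eq_self_of_mem_units hx] at h2
    exact Subtype.ext (Prod.ext h2.symm h1)
  simp [ha]

/-- The sections that are continuous on an open set `V` of units and supported in `K ⊆ V` form an
algebra, on which the sup norm is submultiplicative. -/
theorem mul_mem_supportedIn_of_subset_units {V K : Set G} (hKV : K ⊆ V) (hV : V ⊆ units G)
    {f g : Cc A} (hf : f ∈ Cc.supportedIn A V K) (hg : g ∈ Cc.supportedIn A V K) :
    f * g ∈ Cc.supportedIn A V K ∧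
      Cc.supNorm (f * g) ≤ Cc.supNorm f * Cc.supNorm g := by
  have hfu : ∀ γ ∉ units G, f γ = 0 := fun γ hγ => hf.2 γ fun h => hγ (hV (hKV h))
  have hz : ∀ γ ∉ K, (f * g) γ = 0 := by
    intro γ hγ
    rw [Cc.mul_apply]
    refine (finsum_congr fun p => ?_).trans finsum_zero
    by_cases h1 : p.1.1 ∈ K
    · have h2 := eq_of_isComp_of_mem_units p.2 (hV (hKV h1))
      have h3 : g p.1.2 = 0 := hg.2 _ (by rwa [h2.1])
      simp [h3]
    · have h3 : f p.1.1 = 0 := hf.2 _ h1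
      simp [h3]
  refine ⟨⟨?_, hz⟩, Cc.supNorm_le (mul_nonneg (Cc.supNorm_nonneg f) (Cc.supNorm_nonneg g)) ?_⟩
  · have h1 := hf.1
    have h2 := hg.1
    rw [continuousOn_iff_continuous_domRestrict] at *
    have h3 := (FellBundle.continuous_mul (A := A)).comp
      ((h1.prodMk h2).subtype_mk fun γ => (isComp_self_of_mem_units (hV γ.2)).1)
    convert h3 using 1
    funext γ
    change (⟨γ.1, (f * g) γ.1⟩ : BundleTotal A) = _
    rw [mul_apply_unit hfu (hV γ.2), mk_mul_eq]
    rfl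
  · intro γ
    by_cases hγ : γ ∈ K
    · rw [mul_apply_unit hfu (hV (hKV hγ))]
      exact (norm_mul_le _ _ _).trans (mul_le_mul (Cc.norm_le_supNorm f γ)
        (Cc.norm_le_supNorm g γ) (norm_nonneg _) (Cc.supNorm_nonneg f))
    · rw [hz γ hγ, norm_zero]
      exact mul_nonneg (Cc.supNorm_nonneg f) (Cc.supNorm_nonneg g)

theorem star_apply_inv (h : Cc A) (β : G) : (star h) (inv β) = adj rfl (h β) := by
  have key : ∀ {α' : G} (h1 : α' = β) (k : inv α' = inv β),
      adj k (h α') = adj (rfl : inv β = inv β) (h β) := by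
    intro α' h1 k
    subst h1
    rfl
  exact key (inv_inv_self β) _

/-- At `src β` the sum that defines `h* * h` has the single term `h(β)* h(β)`, since the source map
is injective on the support of `h`. -/
theorem star_mul_self_apply_src {U K : Set G} (hs : Set.InjOn src U) (hKU : K ⊆ U) {h : Cc A}
    (hh : h ∈ Cc.supportedIn A U K) {β : G} (hβ : β ∈ U) :
    (star h * h) (src β) = mul (isComp_inv rfl).1 (adj rfl (h β)) (h β) := by
  rw [Cc.mul_apply]
  refine (finsum_eq_single _ (⟨(inv β, β), (isComp_inv rfl).1⟩ :
    {p : G × G // IsComp p.1 p.2 (src β)}) ?_).trans ?_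
  · rintro ⟨⟨a, b⟩, hp⟩ hne
    have hb : h b = 0 := by
      refine hh.2 b fun hb => hne ?_
      have h1 : b = β := hs (hKU hb) hβ (by rw [← hp.src_eq, src_src])
      subst h1
      exact Subtype.ext (Prod.ext (isComp_left_unique hp (isComp_inv rfl).1) rfl)
    simp [hb]
  · change mul _ ((star h) (inv β)) _ = _
    rw [star_apply_inv]

/-- For `h` supported in a bisection, `h* * h` is supported in the unit space: it is a section over
`s(U)`, supported in `s(K)`. -/
theorem star_mul_self_mem_supportedIn {U K : Set G} (hU : IsRangeSection U)
    (hs : Set.InjOn src U) (hKU : K ⊆ U) {h : Cc A} (hh : h ∈ Cc.supportedIn A U K) :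
    star h * h ∈ Cc.supportedIn A (src '' U) (src '' K) ∧
      Cc.supNorm (star h * h) ≤ Cc.supNorm h ^ 2 := by
  have hz : ∀ γ ∉ src '' K, (star h * h) γ = 0 := by
    intro γ hγ
    rw [Cc.mul_apply]
    refine (finsum_congr fun p => ?_).trans finsum_zero
    by_cases h2 : p.1.2 ∈ K
    · have h1 : (star h) p.1.1 = 0 := by
        rw [Cc.star_apply]
        have : h (inv p.1.1) = 0 := by
          refine hh.2 _ fun h1 => hγ ?_
          -- both `p.1.1⁻¹` and `p.1.2` lie in `U` and have the same range, so they agree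
          have h3 : inv p.1.1 = p.1.2 :=
            hU.injOn (hKU h1) (hKU h2) (by rw [rng_inv, p.2.1])
          refine ⟨p.1.2, h2, ?_⟩
          calc src p.1.2 = rng p.1.1 := by rw [← h3, src_inv]
            _ = comp p.1.1 p.1.2 := (isComp_inv h3).2.2.symm
            _ = γ := p.2.2
        rw [this, map_zero]
      rw [h1, map_zero, LinearMap.zero_apply]
    · have h1 : h p.1.2 = 0 := hh.2 _ h2
      rw [h1, map_zero]
  refine ⟨⟨?_, hz⟩, Cc.supNorm_le (sq_nonneg _) ?_⟩
  · obtain ⟨b, hbc, hb⟩ := exists_continuousOn_inverse_src hU.isOpen hs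
    have h1 : ContinuousOn (fun x => (⟨b x, h (b x)⟩ : BundleTotal A)) (src '' U) :=
      hh.1.comp hbc fun x hx => (hb x hx).1
    have h2 := (FellBundle.continuous_adj (A := A)).comp_continuousOn h1
    rw [continuousOn_iff_continuous_domRestrict] at h1 h2 ⊢
    have h3 := (FellBundle.continuous_mul (A := A)).comp
      ((h2.prodMk h1).subtype_mk fun x => src_inv (b x.1))
    convert h3 using 1
    funext x
    change (⟨x.1, (star h * h) x.1⟩ : BundleTotal A) = _
    have key : ∀ y z : G, y = z →
        (⟨y, (star h * h) y⟩ : BundleTotal A) = ⟨z, (star h * h) z⟩ := by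
      rintro y _ rfl
      rfl
    rw [key _ _ (hb x.1 x.2).2.symm, star_mul_self_apply_src hs hKU hh (hb x.1 x.2).1, mk_mul_eq]
    rfl
  · intro γ
    by_cases hγ : γ ∈ src '' K
    · obtain ⟨β, hβ, rfl⟩ := hγ
      rw [star_mul_self_apply_src hs hKU hh (hKU hβ), norm_adj_mul_self]
      exact pow_le_pow_left₀ (norm_nonneg _) (Cc.norm_le_supNorm h β) 2
    · rw [hz γ hγ, norm_zero]
      exact sq_nonneg _

/-- A partition of unity along a cover of `K` by finitely many open sets on which range and source
are injective. The number of pieces depends on `K` only. -/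
theorem exists_sum_supportedIn {V K : Set G} (hV : IsOpen V) (hT2 : T2Space V)
    (hK : IsCompact K) (hKV : K ⊆ V) :
    ∃ n : ℕ, ∀ h ∈ Cc.supportedIn A V K, ∃ g : Fin n → Cc A, h = ∑ i, g i ∧
      ∀ i, Cc.supNorm (g i) ≤ Cc.supNorm h ∧ ∃ U L : Set G, IsRangeSection U ∧
        Set.InjOn src U ∧ IsCompact L ∧ L ⊆ U ∧ g i ∈ Cc.supportedIn A U L := by
  have hlc := locallyCompactSpace_groupoid G
  have hlcV : LocallyCompactSpace V := hV.isOpenEmbedding_subtypeVal.locallyCompactSpace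
  choose U hxU hU hUs using exists_isRangeSection_injOn_src (G := G)
  obtain ⟨t, ht⟩ := hK.elim_finite_subcover U (fun y => (hU y).isOpen)
    (fun y _ => Set.mem_iUnion.2 ⟨y, hxU y⟩)
  let y : Fin t.card → G := fun i => (t.equivFin.symm i).1
  have hKc : IsCompact ((Subtype.val : V → G) ⁻¹' K) := by
    rw [Subtype.isCompact_iff, Subtype.image_preimage_coe, Set.inter_eq_right.2 hKV]
    exact hK
  obtain ⟨φ, hφU, hφ1, hφI, -⟩ := exists_continuous_sum_one_of_isOpen_isCompact
    (s := fun i => (Subtype.val : V → G) ⁻¹' (U (y i)))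
    (fun i => (hU (y i)).isOpen.preimage continuous_subtype_val) hKc (by
      intro v hv
      obtain ⟨z, hz, hvz⟩ := Set.mem_iUnion₂.1 (ht hv)
      refine Set.mem_iUnion.2 ⟨t.equivFin ⟨z, hz⟩, ?_⟩
      simpa [y] using hvz)
  classical
  let ψ : Fin t.card → G → ℂ := fun i γ => if h : γ ∈ V then (φ i ⟨γ, h⟩ : ℂ) else 0
  have hψ : ∀ i, ContinuousOn (ψ i) V := by
    intro i
    rw [continuousOn_iff_continuous_domRestrict]
    have : V.domRestrict (ψ i) = fun v => (φ i v : ℂ) := by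
      funext v
      simp [ψ, Set.domRestrict]
    rw [this]
    exact Complex.continuous_ofReal.comp (φ i).continuous
  have hψ1 : ∀ i γ, ‖ψ i γ‖ ≤ 1 := by
    intro i γ
    by_cases hγ : γ ∈ V
    · simp only [ψ, hγ, dif_pos, Complex.norm_real, Real.norm_eq_abs]
      exact abs_le.2 ⟨by linarith [(hφI i ⟨γ, hγ⟩).1], (hφI i ⟨γ, hγ⟩).2⟩
    · simp [ψ, hγ]
  refine ⟨t.card, fun f hf => ?_⟩
  let L : Fin t.card → Set G := fun i => Subtype.val '' (Subtype.val ⁻¹' K ∩ tsupport (φ i))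
  have hLc : ∀ i, IsCompact (L i) := fun i =>
    (hKc.inter_right (isClosed_tsupport _)).image continuous_subtype_val
  have hL : ∀ i, L i ⊆ V ∩ U (y i) := by
    rintro i _ ⟨v, ⟨-, hv⟩, rfl⟩
    exact ⟨v.2, hφU i hv⟩
  have hr : ∀ i, IsRangeSection (V ∩ U (y i)) := fun i =>
    ⟨hV.inter (hU _).isOpen, (hU _).injOn.mono Set.inter_subset_right⟩
  have hmem : ∀ i, (fun γ => ψ i γ • f γ) ∈ sectionsOn A (V ∩ U (y i)) (L i) := by
    refine fun i => ⟨continuousOn_smul_section ((hψ i).mono Set.inter_subset_left)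
      (hf.1.mono Set.inter_subset_left), fun γ hγ => ?_⟩
    by_cases hγK : γ ∈ K
    · have h0 : φ i ⟨γ, hKV hγK⟩ = 0 := by
        by_contra h0
        exact hγ ⟨⟨γ, hKV hγK⟩, ⟨hγK, subset_tsupport _ h0⟩, rfl⟩
      simp [ψ, hKV hγK, h0]
    · have h0 : f γ = 0 := hf.2 γ hγK
      simp [h0]
  have hcc : ∀ i, (fun γ => ψ i γ • f γ) ∈ ccSections A := fun i => Submodule.subset_span
    ⟨_, L i, (hr i).isOpen, (hr i).t2Space, hLc i, hL i, hmem i⟩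
  refine ⟨fun i => ⟨fun γ => ψ i γ • f γ, hcc i⟩, ?_, fun i => ⟨?_, _, L i, hr i,
    (hUs _).mono Set.inter_subset_right, hLc i, hL i, hmem i⟩⟩
  · have hsum : f.1 = ∑ i, fun γ => ψ i γ • f γ := by
      funext γ
      rw [Finset.sum_apply, ← Finset.sum_smul]
      change f γ = _
      by_cases hγ : γ ∈ K
      · have h1 := hφ1 (x := ⟨γ, hKV hγ⟩) hγ
        have h2 : ∑ i, ψ i γ = 1 := by
          simp only [ψ, hKV hγ, dif_pos]
          rw [← Complex.ofReal_sum]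
          simp only [Finset.sum_apply, Pi.one_apply] at h1
          rw [h1, Complex.ofReal_one]
        rw [h2, one_smul]
      · have h0 : f γ = 0 := hf.2 γ hγ
        rw [h0, smul_zero]
    refine Subtype.ext (hsum.trans ?_)
    exact (map_sum (ccSections A).subtype
      (fun i => (⟨fun γ => ψ i γ • f γ, hcc i⟩ : ccSections A)) Finset.univ).symm
  · refine Cc.supNorm_le (Cc.supNorm_nonneg f) fun γ => ?_
    change ‖ψ i γ • f γ‖ ≤ _
    rw [norm_smul]
    exact (mul_le_of_le_one_left (norm_nonneg _) (hψ1 i γ)).trans (Cc.norm_le_supNorm f γ)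

end UnitSupport

/-! ### Linear maps on the inductive limit -/

section InductiveLimit

variable {G : Type*} [TopologicalSpace G] {A : G → Type*}
  [∀ γ, NormedAddCommGroup (A γ)] [∀ γ, NormedSpace ℂ (A γ)]
  [TopologicalSpace (BundleTotal A)] [IsUSCBanachBundle A]

/-- A linear functional that is continuous in the inductive limit topology is bounded on each of
the normed spaces whose limit is taken. -/
theorem Cc.exists_norm_le_of_continuous {φ : Cc A →ₗ[ℂ] ℂ} (hφ : Continuous φ) {V K : Set G}
    (hV : IsOpen V) (hT2 : T2Space V) (hK : IsCompact K) (hKV : K ⊆ V) :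
    ∃ C, ∀ f ∈ Cc.supportedIn A V K, ‖φ f‖ ≤ C * Cc.supNorm f := by
  -- each topology in the infimum makes the inclusion continuous, so the infimum does
  have hinc : @Continuous (Cc.supportedIn A V K) (Cc A)
      ((Cc.uniformTopology A).induced Subtype.val) (Cc.inductiveLimitTopology A) Subtype.val :=
    continuous_sInf_rng.2 fun t ht => ht.2.2.2 V K hV hT2 hK hKV
  have hcomp := @Continuous.comp _ _ _ ((Cc.uniformTopology A).induced Subtype.val) _ _ _ _
    hφ hinc
  let _ : NormedAddCommGroup (Cc A) := (Cc.supAddGroupNorm A).toNormedAddCommGroup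
  have hnear : ∃ δ > 0, ∀ f ∈ Cc.supportedIn A V K, Cc.supNorm f < δ → ‖φ f‖ < 1 := by
    have h0 := (@Continuous.continuousAt _ _ ((Cc.uniformTopology A).induced Subtype.val) _ _
      (0 : Cc.supportedIn A V K) hcomp) (Metric.ball_mem_nhds _ one_pos)
    obtain ⟨u, hu, hsub⟩ := (@mem_nhds_induced _ _ (Cc.uniformTopology A) _ _ _).1
      (Filter.mem_map.1 h0)
    obtain ⟨δ, hδ, hball⟩ := Metric.mem_nhds_iff.1 hu
    refine ⟨δ, hδ, fun f hf hfδ => ?_⟩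
    have h1 : f ∈ Metric.ball (0 : Cc A) δ := mem_ball_zero_iff.2 hfδ
    have h2 := @hsub ⟨f, hf⟩ (hball h1)
    simpa using h2
  obtain ⟨δ, hδ, hnear⟩ := hnear
  refine ⟨2 / δ, fun f hf => ?_⟩
  rcases (Cc.supNorm_nonneg f).eq_or_lt with h0 | h0
  · have : f = 0 := (Cc.supAddGroupNorm A).eq_zero_of_map_eq_zero' f h0.symm
    simp [this, Cc.supNorm]
  · -- rescale `f` to sup norm `δ / 2`
    have hc : 0 < δ / 2 / Cc.supNorm f := by positivity
    have h2 : ‖((δ / 2 / Cc.supNorm f : ℝ) : ℂ)‖ = δ / 2 / Cc.supNorm f := by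
      rw [Complex.norm_real, Real.norm_of_nonneg hc.le]
    have h1 := hnear (((δ / 2 / Cc.supNorm f : ℝ) : ℂ) • f) (Submodule.smul_mem _ _ hf) (by
      refine (Cc.supNorm_le (C := δ / 2) (by positivity) fun γ => ?_).trans_lt (by linarith)
      rw [Cc.smul_apply, norm_smul, h2]
      calc δ / 2 / Cc.supNorm f * ‖f γ‖ ≤ δ / 2 / Cc.supNorm f * Cc.supNorm f := by
            gcongr
            exact Cc.norm_le_supNorm f γ
        _ = δ / 2 := by field_simp)
    rw [map_smul, norm_smul, h2, div_mul_eq_mul_div, div_lt_one h0] at h1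
    rw [div_mul_eq_mul_div, le_div_iff₀ hδ]
    nlinarith

/-- A linear map into a normed space is continuous in the inductive limit topology if it is bounded
on each of the normed spaces whose limit is taken. -/
theorem Cc.continuous_of_forall_exists_norm_le {E : Type*} [NormedAddCommGroup E] [NormedSpace ℂ E]
    (T : Cc A →ₗ[ℂ] E)
    (hT : ∀ V K : Set G, IsOpen V → T2Space V → IsCompact K → K ⊆ V →
      ∃ C, ∀ f ∈ Cc.supportedIn A V K, ‖T f‖ ≤ C * Cc.supNorm f) :
    Continuous T := by
  -- the topology induced by `T` is one of those over which the infimum is taken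
  let tE : TopologicalSpace E := inferInstance
  refine continuous_sInf_dom (t := tE.induced T) ⟨?_, ?_, ?_, ?_⟩ continuous_induced_dom
  · exact topologicalAddGroup_induced T
  · exact continuousSMul_induced T
  · let _ : NormedSpace ℝ E := NormedSpace.complexToReal
    exact LocallyConvexSpace.induced (T.restrictScalars ℝ)
  · intro V K hV hT2 hK hKV
    obtain ⟨C, hC⟩ := hT V K hV hT2 hK hKV
    refine @continuous_induced_rng _ _ _ _ _ (_) _ |>.2 ?_
    let _ : SeminormedAddCommGroup (Cc.supportedIn A V K) :=
      @SeminormedAddCommGroup.induced _ _ _ _ _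
        (Cc.supAddGroupNorm A).toNormedAddCommGroup.toSeminormedAddCommGroup.toSeminormedAddGroup _
        (Cc.supportedIn A V K).subtype
    exact AddMonoidHomClass.continuous_of_bound (T.comp (Cc.supportedIn A V K).subtype) C
      fun f => hC f.1 f.2

end InductiveLimit

/-! ### Boundedness of pre-representations -/

/-- A comparison of exponential growth rates along the exponents `2 ^ n`. -/
theorem le_of_forall_pow_two_pow_le {r c C : ℝ} (hc : 0 ≤ c)
    (h : ∀ n : ℕ, r ^ 2 ^ n ≤ C * c ^ 2 ^ n) : r ≤ c := by
  by_contra! hlt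
  rcases hc.eq_or_lt with rfl | hc
  · have := h 0
    simp at this
    linarith
  · obtain ⟨m, hm⟩ := pow_unbounded_of_one_lt C ((one_lt_div hc).2 hlt)
    have h1 : (r / c) ^ m ≤ (r / c) ^ 2 ^ m :=
      pow_le_pow_right₀ ((one_lt_div hc).2 hlt).le m.lt_two_pow_self.le
    have h2 : (r / c) ^ 2 ^ m ≤ C := by
      rw [div_pow]
      exact (div_le_iff₀ (by positivity)).2 (h m)
    linarith

section PreRepresentation

variable {G : Type*} [TopologicalSpace G] [ArrowGroupoid G] [IsEtaleGroupoid G] {A : G → Type*}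
  [∀ γ, NormedAddCommGroup (A γ)] [∀ γ, NormedSpace ℂ (A γ)]
  [TopologicalSpace (BundleTotal A)] [FellBundle A]
  {H : Type*} [NormedAddCommGroup H] [InnerProductSpace ℂ H]
  {H₀ : Submodule ℂ H} {L : Cc A →ₙₐ[ℂ] Module.End ℂ H₀}

/-- The matrix coefficient `f ↦ ⟨η, L(f) ξ⟩`, as a linear functional on `C_c(G; A)`. -/
noncomputable def matrixCoeff (L : Cc A →ₙₐ[ℂ] Module.End ℂ H₀) (ξ η : H₀) : Cc A →ₗ[ℂ] ℂ where
  toFun f := inner ℂ (η : H) (L f ξ : H)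
  map_add' f g := by simp
  map_smul' c f := by simp

namespace IsPreRepresentation

theorem norm_apply_sq (hL : IsPreRepresentation H₀ L) (f : Cc A) (ξ : H₀) :
    ‖L f ξ‖ ^ 2 = ‖matrixCoeff L ξ ξ (star f * f)‖ := by
  change _ = ‖inner ℂ (ξ : H) (L (star f * f) ξ : H)‖
  rw [map_mul, Module.End.mul_apply, hL.inner_apply, star_star, inner_self_eq_norm_sq_to_K]
  simp

/-- Cauchy-Schwarz for `b = b*` and `ξ`: `|⟨ξ, L(b) ξ⟩|² ≤ ‖ξ‖² |⟨ξ, L(b²) ξ⟩|`. -/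
theorem norm_matrixCoeff_sq_le (hL : IsPreRepresentation H₀ L) {b : Cc A} (hb : star b = b)
    (ξ : H₀) :
    ‖matrixCoeff L ξ ξ b‖ ^ 2 ≤ ‖ξ‖ ^ 2 * ‖matrixCoeff L ξ ξ (b * b)‖ := by
  have h1 := hL.norm_apply_sq b ξ
  rw [hb] at h1
  rw [← h1, ← mul_pow]
  exact pow_le_pow_left₀ (norm_nonneg _) (norm_inner_le_norm _ _) 2

/-- The iterated Cauchy-Schwarz inequality, for `b = b*`. The iterate in the statement is the power
`b ^ (2 ^ n)`, which has no power notation since the algebra has no unit. -/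
theorem norm_matrixCoeff_pow_le (hL : IsPreRepresentation H₀ L) {b : Cc A} (hb : star b = b)
    {ξ : H₀} (hξ : ξ ≠ 0) (n : ℕ) :
    (‖matrixCoeff L ξ ξ b‖ / ‖ξ‖ ^ 2) ^ 2 ^ n ≤
      ‖matrixCoeff L ξ ξ ((fun a => a * a)^[n] b)‖ / ‖ξ‖ ^ 2 := by
  induction n generalizing b with
  | zero => simp
  | succ n ih =>
    have hpos : 0 < ‖ξ‖ ^ 2 := by positivity
    have h1 := hL.norm_matrixCoeff_sq_le hb ξ
    have h2 := ih (b := b * b) (by rw [star_mul, hb])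
    rw [Function.iterate_succ_apply]
    refine le_trans ?_ h2
    rw [pow_succ' 2 n, pow_mul]
    refine pow_le_pow_left₀ (by positivity) ?_ _
    rw [div_pow, div_le_div_iff₀ (by positivity) hpos]
    nlinarith

/-- `L h` is bounded by `‖h‖_∞` if `h` is supported in a bisection. The constant in the continuity
estimate for the matrix coefficient disappears when `2 ^ n`-th roots are taken. -/
theorem norm_apply_le (hL : IsPreRepresentation H₀ L) {U K : Set G} (hU : IsRangeSection U)
    (hs : Set.InjOn src U) (hK : IsCompact K) (hKU : K ⊆ U) {h : Cc A}
    (hh : h ∈ Cc.supportedIn A U K) (ξ : H₀) : ‖L h ξ‖ ≤ Cc.supNorm h * ‖ξ‖ := by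
  rcases eq_or_ne ξ 0 with rfl | hξ
  · simp
  have hVu : src '' U ⊆ units G := by
    rintro _ ⟨γ, -, rfl⟩
    exact src_mem_units γ
  have hV := isOpen_image_src hU.isOpen
  have hKV : src '' K ⊆ src '' U := Set.image_mono hKU
  obtain ⟨C, hC⟩ := Cc.exists_norm_le_of_continuous (φ := matrixCoeff L ξ ξ)
    (hL.continuous_inner ξ ξ) hV (isRangeSection_of_subset_units hV hVu).t2Space
    (hK.image (IsTopologicalGroupoid.continuous_src (G := G))) hKV
  obtain ⟨hb, hbn⟩ := star_mul_self_mem_supportedIn hU hs hKU hh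
  have hiter : ∀ (n : ℕ), (fun a => a * a)^[n] (star h * h) ∈
      Cc.supportedIn A (src '' U) (src '' K) ∧
      Cc.supNorm ((fun a => a * a)^[n] (star h * h)) ≤ (Cc.supNorm h ^ 2) ^ 2 ^ n := by
    intro n
    induction n with
    | zero => simpa using ⟨hb, hbn⟩
    | succ n ih =>
      rw [Function.iterate_succ_apply']
      obtain ⟨h1, h2⟩ := mul_mem_supportedIn_of_subset_units hKV hVu ih.1 ih.1
      refine ⟨h1, h2.trans ?_⟩
      rw [pow_succ 2 n, pow_mul, sq (_ ^ 2 ^ n)]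
      exact mul_le_mul ih.2 ih.2 (Cc.supNorm_nonneg _) (by positivity)
  have hpos : 0 < ‖ξ‖ ^ 2 := by positivity
  have key : ‖matrixCoeff L ξ ξ (star h * h)‖ / ‖ξ‖ ^ 2 ≤ Cc.supNorm h ^ 2 := by
    refine le_of_forall_pow_two_pow_le (C := |C| / ‖ξ‖ ^ 2) (sq_nonneg _) fun n => ?_
    refine (hL.norm_matrixCoeff_pow_le (by rw [star_mul, star_star]) hξ n).trans ?_
    rw [div_mul_eq_mul_div]
    gcongr
    refine (hC _ (hiter n).1).trans (mul_le_mul (le_abs_self C) (hiter n).2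
      (Cc.supNorm_nonneg _) (abs_nonneg C))
  rw [← hL.norm_apply_sq, div_le_iff₀ hpos, ← mul_pow] at key
  exact (pow_le_pow_iff_left₀ (norm_nonneg _)
    (mul_nonneg (Cc.supNorm_nonneg h) (norm_nonneg _)) two_ne_zero).1 key

/-- The constant `C` is the number of bisections needed to cover `K`. -/
theorem exists_norm_apply_le_supNorm (hL : IsPreRepresentation H₀ L) {V K : Set G}
    (hV : IsOpen V) (hT2 : T2Space V) (hK : IsCompact K) (hKV : K ⊆ V) :
    ∃ C : ℝ, 0 ≤ C ∧ ∀ h ∈ Cc.supportedIn A V K, ∀ ξ : H₀,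
      ‖L h ξ‖ ≤ C * Cc.supNorm h * ‖ξ‖ := by
  obtain ⟨n, hn⟩ := exists_sum_supportedIn (A := A) hV hT2 hK hKV
  refine ⟨n, n.cast_nonneg, fun h hh ξ => ?_⟩
  obtain ⟨g, hg, hgi⟩ := hn h hh
  conv_lhs => rw [hg]
  rw [map_sum, LinearMap.sum_apply]
  refine (norm_sum_le _ _).trans ((Finset.sum_le_sum fun i _ => ?_).trans_eq
    (b := ∑ _i : Fin n, Cc.supNorm h * ‖ξ‖) (by simp; ring))
  obtain ⟨h1, U, K', hU, hs, hK', hKU, hm⟩ := hgi i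
  exact (hL.norm_apply_le hU hs hK' hKU hm ξ).trans
    (mul_le_mul_of_nonneg_right h1 (norm_nonneg _))

theorem exists_norm_apply_le (hL : IsPreRepresentation H₀ L) (h : Cc A) :
    ∃ C, ∀ ξ : H₀, ‖L h ξ‖ ≤ C * ‖ξ‖ := by
  have hspan : ∀ f (hf : f ∈ ccSections A), ∃ C, ∀ ξ : H₀,
      ‖L (⟨f, hf⟩ : Cc A) ξ‖ ≤ C * ‖ξ‖ := by
    intro f hf
    induction hf using Submodule.span_induction with
    | mem f hf =>
      obtain ⟨V, K, hV, hT2, hK, hKV, hm⟩ := hf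
      obtain ⟨C, -, hC⟩ := hL.exists_norm_apply_le_supNorm hV hT2 hK hKV
      exact ⟨_, hC _ hm⟩
    | zero =>
      refine ⟨0, fun ξ => ?_⟩
      have : L (⟨0, Submodule.zero_mem _⟩ : Cc A) = 0 := map_zero L
      rw [this]
      simp
    | add f g hf hg ihf ihg =>
      obtain ⟨C, hC⟩ := ihf
      obtain ⟨D, hD⟩ := ihg
      refine ⟨C + D, fun ξ => ?_⟩
      have : L (⟨f + g, Submodule.add_mem _ hf hg⟩ : Cc A) =
        L (⟨f, hf⟩ : Cc A) + L (⟨g, hg⟩ : Cc A) := map_add L (⟨f, hf⟩ : Cc A) ⟨g, hg⟩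
      rw [this, add_mul]
      exact (norm_add_le _ _).trans (add_le_add (hC ξ) (hD ξ))
    | smul c f hf ih =>
      obtain ⟨C, hC⟩ := ih
      refine ⟨‖c‖ * C, fun ξ => ?_⟩
      have : L (⟨c • f, Submodule.smul_mem _ c hf⟩ : Cc A) =
        c • L (⟨f, hf⟩ : Cc A) := map_smul L c (⟨f, hf⟩ : Cc A)
      rw [this, LinearMap.smul_apply, norm_smul, _root_.mul_assoc]
      exact mul_le_mul_of_nonneg_left (hC ξ) (norm_nonneg c)
  exact hspan h.1 h.2

/-! ### Extension to the Hilbert space -/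

theorem spanRange_le (L : Cc A →ₙₐ[ℂ] Module.End ℂ H₀) : spanRange L ≤ H₀ := by
  refine Submodule.span_le.2 ?_
  rintro _ ⟨f, ξ, rfl⟩
  exact (L f ξ).2

theorem denseRange_subtype (hL : IsPreRepresentation H₀ L) :
    DenseRange (H₀.subtype : H₀ → H) := by
  refine hL.dense_spanRange.mono ?_
  intro v hv
  exact ⟨⟨v, spanRange_le L hv⟩, rfl⟩

theorem continuousLinearMap_ext (hL : IsPreRepresentation H₀ L) {S T : H →L[ℂ] H}
    (h : ∀ ξ : H₀, S ξ = T ξ) : S = T :=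
  ContinuousLinearMap.ext fun v => congrFun
    (hL.denseRange_subtype.equalizer S.continuous T.continuous (funext h)) v

variable [CompleteSpace H]

/-- The bounded operator on `H` that extends `L h`. For a pre-representation `L` the operator `L h`
is bounded and densely defined; otherwise this is a junk value. -/
noncomputable def extendApply (L : Cc A →ₙₐ[ℂ] Module.End ℂ H₀) (h : Cc A) : H →L[ℂ] H :=
  (H₀.subtype ∘ₗ L h).extendOfNorm H₀.subtype

theorem extendApply_coe (hL : IsPreRepresentation H₀ L) (h : Cc A) (ξ : H₀) :
    extendApply L h (ξ : H) = L h ξ :=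
  LinearMap.extendOfNorm_eq (f := H₀.subtype ∘ₗ L h) hL.denseRange_subtype
    (hL.exists_norm_apply_le h) ξ

/-- The representation on `H` that extends the pre-representation `L`. -/
noncomputable def toRepresentation (hL : IsPreRepresentation H₀ L) :
    Cc A →⋆ₙₐ[ℂ] (H →L[ℂ] H) where
  toFun := extendApply L
  map_smul' c h := hL.continuousLinearMap_ext fun ξ => by
    simp [hL.extendApply_coe]
  map_zero' := hL.continuousLinearMap_ext fun ξ => by
    simp [hL.extendApply_coe]
  map_add' f g := hL.continuousLinearMap_ext fun ξ => by
    simp [hL.extendApply_coe]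
  map_mul' f g := hL.continuousLinearMap_ext fun ξ => by
    simp [hL.extendApply_coe]
  map_star' f := hL.continuousLinearMap_ext fun ξ => by
    refine hL.denseRange_subtype.eq_of_inner_left (𝕜 := ℂ) ?_
    rintro η
    change inner ℂ _ (η : H) = inner ℂ _ (η : H)
    rw [ContinuousLinearMap.star_eq_adjoint, ContinuousLinearMap.adjoint_inner_left,
      hL.extendApply_coe, hL.extendApply_coe, hL.inner_apply]

theorem toRepresentation_coe (hL : IsPreRepresentation H₀ L) (h : Cc A) (ξ : H₀) :
    hL.toRepresentation h (ξ : H) = L h ξ :=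
  hL.extendApply_coe h ξ

theorem norm_toRepresentation_apply_le (hL : IsPreRepresentation H₀ L) {h : Cc A} {C : ℝ}
    (hC : ∀ ξ : H₀, ‖L h ξ‖ ≤ C * ‖ξ‖) (v : H) : ‖hL.toRepresentation h v‖ ≤ C * ‖v‖ :=
  LinearMap.norm_extendOfNorm_apply_le (f := H₀.subtype ∘ₗ L h) hL.denseRange_subtype C hC v

theorem isNondegenerate_toRepresentation (hL : IsPreRepresentation H₀ L) :
    IsNondegenerate hL.toRepresentation := by
  refine hL.dense_spanRange.mono (Submodule.span_mono ?_)
  rintro _ ⟨f, ξ, rfl⟩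
  exact ⟨f, ξ, (hL.toRepresentation_coe f ξ).symm⟩

theorem continuous_toRepresentation (hL : IsPreRepresentation H₀ L) :
    Continuous hL.toRepresentation := by
  refine Cc.continuous_of_forall_exists_norm_le
    (hL.toRepresentation : Cc A →ₗ[ℂ] (H →L[ℂ] H)) fun V K hV hT2 hK hKV => ?_
  obtain ⟨C, hC0, hC⟩ := hL.exists_norm_apply_le_supNorm hV hT2 hK hKV
  exact ⟨C, fun f hf => ContinuousLinearMap.opNorm_le_bound _
    (mul_nonneg hC0 (Cc.supNorm_nonneg f)) (hL.norm_toRepresentation_apply_le (hC f hf))⟩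

end IsPreRepresentation

end PreRepresentation

end FellBundle

theorem proposition2p5
    {G : Type*} [TopologicalSpace G] [ArrowGroupoid G] [IsEtaleGroupoid G]
    {A : G → Type*} [∀ γ, NormedAddCommGroup (A γ)] [∀ γ, NormedSpace ℂ (A γ)]
    [TopologicalSpace (BundleTotal A)] [FellBundle A]
    {H : Type*} [NormedAddCommGroup H] [InnerProductSpace ℂ H] [CompleteSpace H]
    (H₀ : Submodule ℂ H) (L : FellBundle.Cc A →ₙₐ[ℂ] Module.End ℂ H₀)
    (hL : FellBundle.IsPreRepresentation H₀ L) :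
    -- the formula `M'(h)(L(f) ξ) = L(h * f) ξ` defines linear operators `M'(h)` on `H₀₀`
    ∃ M' : FellBundle.Cc A → Module.End ℂ (FellBundle.spanRange L),
      (∀ (h f : FellBundle.Cc A) (ξ : H₀),
        M' h ⟨L f ξ, FellBundle.apply_mem_spanRange L f ξ⟩ =
          ⟨L (h * f) ξ, FellBundle.apply_mem_spanRange L (h * f) ξ⟩) ∧
      ∃ M : FellBundle.Cc A →⋆ₙₐ[ℂ] (H →L[ℂ] H),
        (∀ (h : FellBundle.Cc A) (v : FellBundle.spanRange L), M h (v : H) = M' h v) ∧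
        (∀ N : FellBundle.Cc A → (H →L[ℂ] H),
          (∀ (h f : FellBundle.Cc A) (ξ : H₀), N h (L f ξ : H) = L (h * f) ξ) → ∀ h, N h = M h) ∧
        FellBundle.IsNondegenerate M ∧
        Continuous M ∧
        (∀ (h : FellBundle.Cc A) (ξ : H₀), M h (ξ : H) = L h ξ) ∧
        (∀ U K : Set G, IsBisection U → IsCompact K → K ⊆ U →
          ∀ h ∈ FellBundle.Cc.supportedIn A U K, ∀ v : H,
            ‖M h v‖ ≤ FellBundle.Cc.supNorm h * ‖v‖) := by
  have hM := hL.toRepresentation_coe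
  have hmul : ∀ (h f : FellBundle.Cc A) (ξ : H₀),
      hL.toRepresentation h (L f ξ : H) = L (h * f) ξ := fun h f ξ => by
    rw [hM, map_mul, Module.End.mul_apply]
  have hmaps : ∀ (h : FellBundle.Cc A), ∀ v ∈ FellBundle.spanRange L,
      hL.toRepresentation h v ∈ FellBundle.spanRange L := fun h v hv => by
    have := hM h ⟨v, FellBundle.IsPreRepresentation.spanRange_le L hv⟩
    exact this ▸ FellBundle.apply_mem_spanRange L h _
  refine ⟨fun h => (hL.toRepresentation h).toLinearMap.restrict (hmaps h),
    fun h f ξ => Subtype.ext (hmul h f ξ), hL.toRepresentation, fun h v => rfl,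
    fun N hN h => ?_, hL.isNondegenerate_toRepresentation, hL.continuous_toRepresentation, hM,
    fun U K hU hK hKU h hh v => ?_⟩
  · refine ContinuousLinearMap.ext_on hL.dense_spanRange ?_
    rintro _ ⟨f, ξ, rfl⟩
    rw [hN, hmul]
  · have hr : Set.InjOn (rng : G → G) U := fun a ha b hb hab => congrArg Subtype.val
      (hU.rng_isOpenEmbedding.injective (a₁ := ⟨a, ha⟩) (a₂ := ⟨b, hb⟩) (Subtype.ext hab))
    have hs : Set.InjOn (src : G → G) U := fun a ha b hb hab => congrArg Subtype.val
      (hU.src_isOpenEmbedding.injective (a₁ := ⟨a, ha⟩) (a₂ := ⟨b, hb⟩) (Subtype.ext hab))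
    exact hL.norm_toRepresentation_apply_le
      (hL.norm_apply_le ⟨hU.isOpen, hr⟩ hs hK hKU hh) v
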